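/- Let $F=F(A)$ be a free group with a fixed free basis $A=\{a_1,\dots,a_k\}$, $k\ge 2$, let $\Sigma=A\cup A^{-1}$, and let $X$ be the Cayley graph of $F$ with respect to $A$. A geodesic current on $F$ is an $F$-invariant, locally finite positive Radon measure on $\partial^2F=\{(\zeta,\xi)\in\partial F\times\partial F:\zeta\ne\xi\}$. An automorphism $\phi\in Aut(F)$ acts on currents by $(\phi\nu)(S)=\nu((\partial^2\phi)^{-1}(S))$, where $\partial^2\phi$ is the homeomorphism of $\partial^2F$ induced by $\phi$. For a geodesic segment $\gamma=[x,y]$ in $X$ with $x\neq y\in F$, let $Cyl_X(\gamma)\subseteq\partial^2F$ be the set of all $(\zeta,\xi)$ such that the geodesic in $X$ from $\zeta$ to $\xi$ passes through $\gamma$ in the direction from $x$ to $y$; for $v\in F\setminus\{1\}$ put $\langle v,\nu\rangle=\nu(Cyl_X([1,v]))$. The length of a current is $L(\nu)=\sum_{a\in\Sigma}\langle a,\nu\rangle$. The uniform current $n_A$ is the geodesic current with $n_A(Cyl_X(\gamma))=\frac{1}{2k(2k-1)^{|\gamma|-1}}$ for every $\gamma$ as above. A relabelling automorphism is an automorphism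 of $F$ that permutes $\Sigma$; an automorphism is simple if it is the composition of an inner automorphism and a relabelling automorphism. A Whitehead automorphism of the second kind is an automorphism $\tau$ of $F$ for which there is $a\in\Sigma$ such that $\tau(x)\in\{x,\,xa,\,a^{-1}x,\,a^{-1}xa\}$ for every $x\in\Sigma$. **Proposition (Ideal Whitehead Algorithm).** Let $\phi\in Aut(F)$ be an automorphism that is not simple. Then there exists a Whitehead automorphism $\tau$ of the second kind such that $$1=L(n_A)\le L(\tau\phi\, n_A)<L(\phi\, n_A).$$ -/

import Mathlib

open Filter Topology MeasureTheory
open scoped ENNReal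

namespace FreeCurrents

/-- The alphabet `Σ = A ∪ A⁻¹`: `(i, true)` is `a_i` and `(i, false)` is `a_i⁻¹`. -/
abbrev Letter (k : ℕ) : Type := Fin k × Bool

/-- The letter `s ∈ Σ` as an element of the free group `F = F(A)`. -/
def letter {k : ℕ} (s : Letter k) : FreeGroup (Fin k) := FreeGroup.mk [s]

/-- The boundary `∂F`: semi-infinite freely reduced words over `Σ` (two consecutive letters with
the same underlying generator have the same sign). -/
def Boundary (k : ℕ) : Type :=
  {ω : ℕ → Letter k // ∀ n, (ω n).1 = (ω (n + 1)).1 → (ω n).2 = (ω (n + 1)).2}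

/-- The Cantor-set topology: topology of pointwise convergence of letters. -/
instance (k : ℕ) : TopologicalSpace (Boundary k) :=
  inferInstanceAs (TopologicalSpace
    {ω : ℕ → Letter k // ∀ n, (ω n).1 = (ω (n + 1)).1 → (ω n).2 = (ω (n + 1)).2})

instance (k : ℕ) : MeasurableSpace (Boundary k) := borel _

instance (k : ℕ) : BorelSpace (Boundary k) := ⟨rfl⟩

/-- The initial segment `ω_n ∈ F` of length `n` of `ω ∈ ∂F`. -/
def pre {k : ℕ} (ω : Boundary k) (n : ℕ) : FreeGroup (Fin k) :=
  FreeGroup.mk ((List.range n).map ω.1)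

/-- A sequence in `F` converges to `ω ∈ ∂F` (in the compactification `F ∪ ∂F`): every letter of
the reduced words stabilizes to the corresponding letter of `ω`. -/
def ConvergesTo {k : ℕ} (u : ℕ → FreeGroup (Fin k)) (ω : Boundary k) : Prop :=
  ∀ i, ∀ᶠ n in atTop, (u n).toWord[i]? = some (ω.1 i)

/-- The extension to the boundary of a map `f : F → F`: the point `ω = lim ω_n` is sent to
`lim f(ω_n)`. (The default value `ω` is never used for the maps to which this is applied:
automorphisms and left translations, see `exists_convergesTo`.) -/
noncomputable def bdMap {k : ℕ} (f : FreeGroup (Fin k) → FreeGroup (Fin k)) (ω : Boundary k) :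
    Boundary k :=
  open Classical in
  if h : ∃ ξ, ConvergesTo (fun n => f (pre ω n)) ξ then h.choose else ω

section words

variable {k : ℕ}

theorem toWord_pre (ω : Boundary k) (n : ℕ) : (pre ω n).toWord = (List.range n).map ω.1 := by
  rw [pre, FreeGroup.toWord_mk]
  apply FreeGroup.IsReduced.reduce_eq
  rw [FreeGroup.IsReduced, List.isChain_iff_getElem]
  intro i hi
  simpa using ω.2 i

theorem norm_pre (ω : Boundary k) (n : ℕ) : (pre ω n).norm = n := by
  simp [FreeGroup.norm, toWord_pre]

/-- `g` is an initial segment of `h`. -/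
def IsPre (g h : FreeGroup (Fin k)) : Prop := g.toWord <+: h.toWord

theorem isPre_iff {g h : FreeGroup (Fin k)} :
    IsPre g h ↔ ∀ i < g.norm, h.toWord[i]? = g.toWord[i]? := by
  rw [IsPre, List.prefix_iff_getElem?]
  constructor
  · intro H i hi
    rw [H i hi, List.getElem?_eq_getElem hi]
  · intro H i hi
    rw [H i hi, List.getElem?_eq_getElem hi]

theorem getElem?_pre {ω : Boundary k} {n i : ℕ} (h : i < n) :
    (pre ω n).toWord[i]? = some (ω.1 i) := by
  rw [toWord_pre]; simp [h]

theorem convergesTo_iff {u : ℕ → FreeGroup (Fin k)} {ω : Boundary k} :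
    ConvergesTo u ω ↔ ∀ N, ∀ᶠ n in atTop, IsPre (pre ω N) (u n) := by
  constructor
  · intro h N
    have : ∀ᶠ n in atTop, ∀ i ∈ Finset.range N, (u n).toWord[i]? = some (ω.1 i) :=
      (Filter.eventually_all_finset _).2 fun i _ => h i
    filter_upwards [this] with n hn
    rw [isPre_iff, norm_pre]
    intro i hi
    rw [hn i (Finset.mem_range.2 hi), getElem?_pre hi]
  · intro h i
    filter_upwards [h (i + 1)] with n hn
    rw [isPre_iff, norm_pre] at hn
    rw [hn i (Nat.lt_succ_self i), getElem?_pre (Nat.lt_succ_self i)]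

theorem convergesTo_pre (ω : Boundary k) : ConvergesTo (pre ω) ω := by
  intro i
  filter_upwards [eventually_gt_atTop i] with n hn
  exact getElem?_pre hn

theorem ConvergesTo.unique {u : ℕ → FreeGroup (Fin k)} {ω ξ : Boundary k}
    (h : ConvergesTo u ω) (h' : ConvergesTo u ξ) : ω = ξ := by
  apply Subtype.ext
  funext i
  obtain ⟨n, h1, h2⟩ := ((h i).and (h' i)).exists
  exact Option.some_injective _ (h1.symm.trans h2)

theorem pre_isPre (ω : Boundary k) {m n : ℕ} (h : m ≤ n) : IsPre (pre ω m) (pre ω n) := by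
  rw [isPre_iff, norm_pre]
  intro i hi
  rw [getElem?_pre hi, getElem?_pre (hi.trans_le h)]

theorem norm_letter (s : Letter k) : (letter s).norm = 1 := by
  simp [letter, FreeGroup.norm]

theorem toWord_mul_letter (g : FreeGroup (Fin k)) (s : Letter k) :
    (g * letter s).toWord = g.toWord ++ [s] ∨
      g.toWord = (g * letter s).toWord ++ [(s.1, !s.2)] := by
  rcases List.eq_nil_or_concat g.toWord with h | ⟨L, t, h⟩
  · left
    rw [FreeGroup.toWord_mul, h]; simp [letter]
  · rw [List.concat_eq_append] at h
    have hred : FreeGroup.IsReduced (L ++ [t]) := by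
      have := FreeGroup.isReduced_toWord (x := g)
      rwa [h] at this
    have hg : g = FreeGroup.mk (L ++ [t]) := by rw [← h, FreeGroup.mk_toWord]
    by_cases hc : t.1 = s.1 → t.2 = s.2
    · left
      rw [FreeGroup.toWord_mul, h]
      simp only [letter, FreeGroup.toWord_mk, FreeGroup.reduce_singleton]
      apply FreeGroup.IsReduced.reduce_eq
      apply FreeGroup.IsReduced.append_overlap hred _ (by simp)
      simpa using hc
    · right
      push Not at hc
      have ht : t = (s.1, !s.2) := Prod.ext hc.1 (Bool.eq_not.2 hc.2)
      have : g * letter s = FreeGroup.mk L := by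
        rw [hg, ht, ← FreeGroup.mul_mk, mul_assoc]
        have : FreeGroup.mk [(s.1, !s.2)] = (letter s)⁻¹ := by
          simp [letter, FreeGroup.inv_mk, FreeGroup.invRev]
        rw [this, inv_mul_cancel, mul_one]
      rw [this, FreeGroup.toWord_mk,
        (hred.infix (List.prefix_append L [t]).isInfix).reduce_eq, h, ht]

theorem getElem?_mul_letter (g : FreeGroup (Fin k)) (s : Letter k) {i : ℕ} (h : i + 1 < g.norm) :
    (g * letter s).toWord[i]? = g.toWord[i]? := by
  rcases toWord_mul_letter g s with H | H
  · rw [H, List.getElem?_append_left (by simp only [FreeGroup.norm] at h; omega)]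
  · have : i < (g * letter s).toWord.length := by
      simp only [FreeGroup.norm] at h
      rw [H] at h; simp at h; omega
    rw [H, List.getElem?_append_left this]

theorem getElem?_mul_mk (L : List (Letter k)) (g : FreeGroup (Fin k)) {i : ℕ}
    (h : i + L.length < g.norm) :
    (g * FreeGroup.mk L).toWord[i]? = g.toWord[i]? := by
  induction L generalizing g with
  | nil => simp [← FreeGroup.one_eq_mk]
  | cons s L ih =>
    have e : g * FreeGroup.mk (s :: L) = g * letter s * FreeGroup.mk L := by
      rw [mul_assoc, letter, FreeGroup.mul_mk]; rfl
    have hn : g.norm ≤ (g * letter s).norm + 1 := by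
      have := FreeGroup.norm_mul_le (g * letter s) (letter s)⁻¹
      rwa [mul_inv_cancel_right, FreeGroup.norm_inv_eq, norm_letter] at this
    simp only [List.length_cons] at h
    rw [e, ih _ (by omega), getElem?_mul_letter _ _ (by omega)]

/-- Right multiplication by a short element does not change the first letters. -/
theorem getElem?_mul (g h : FreeGroup (Fin k)) {i : ℕ} (hi : i + h.norm < g.norm) :
    (g * h).toWord[i]? = g.toWord[i]? := by
  rw [← FreeGroup.mk_toWord (x := h)]
  exact getElem?_mul_mk _ _ hi

theorem IsPre.refl (g : FreeGroup (Fin k)) : IsPre g g := List.prefix_refl _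

theorem IsPre.trans {g h l : FreeGroup (Fin k)} (H : IsPre g h) (H' : IsPre h l) : IsPre g l :=
  List.IsPrefix.trans H H'

theorem IsPre.norm_le {g h : FreeGroup (Fin k)} (H : IsPre g h) : g.norm ≤ h.norm :=
  List.IsPrefix.length_le H

theorem IsPre.eq_of_norm {g h : FreeGroup (Fin k)} (H : IsPre g h) (h' : h.norm ≤ g.norm) :
    g = h :=
  FreeGroup.toWord_injective (List.IsPrefix.eq_of_length_le H h')

/-- Two initial segments of one element are comparable. -/
theorem IsPre.of_le {g h l : FreeGroup (Fin k)} (H : IsPre g l) (H' : IsPre h l)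
    (hn : g.norm ≤ h.norm) : IsPre g h :=
  List.prefix_of_prefix_length_le H H' hn

/-- Left multiplication by one letter preserves the prefix relation above nontrivial elements. -/
theorem IsPre.letter_mul {g h : FreeGroup (Fin k)} (H : IsPre g h) (hg : g ≠ 1) (s : Letter k) :
    IsPre (letter s * g) (letter s * h) := by
  obtain ⟨L, hL⟩ := H
  have hg' : g.toWord ≠ [] := by simpa using hg
  obtain ⟨t, T, hT⟩ := List.exists_cons_of_ne_nil hg'
  have key : ∀ x : FreeGroup (Fin k), ∀ X, x.toWord = t :: X →
      (letter s * x).toWord = if s.1 = t.1 ∧ s.2 = !t.2 then X else s :: t :: X := by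
    intro x X hx
    have hr : FreeGroup.reduce (t :: X) = t :: X := by rw [← hx]; simp
    rw [FreeGroup.toWord_mul, hx]
    simp only [letter, FreeGroup.toWord_mk, FreeGroup.reduce_singleton, List.singleton_append]
    rw [FreeGroup.reduce.cons, hr]
  rw [IsPre, key g T hT, key h (T ++ L) (by rw [← hL, hT]; rfl)]
  split_ifs
  · exact List.prefix_append _ _
  · exact ⟨L, by simp⟩

theorem norm_le_mul (g h : FreeGroup (Fin k)) : h.norm ≤ g.norm + (g * h).norm := by
  have := FreeGroup.norm_mul_le g⁻¹ (g * h)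
  rwa [inv_mul_cancel_left, FreeGroup.norm_inv_eq] at this

theorem norm_le_mul' (g h : FreeGroup (Fin k)) : g.norm ≤ (g * h).norm + h.norm := by
  have := FreeGroup.norm_mul_le (g * h) h⁻¹
  rwa [mul_inv_cancel_right, FreeGroup.norm_inv_eq] at this

theorem IsPre.mk_mul {g h : FreeGroup (Fin k)} (H : IsPre g h) (L : List (Letter k))
    (hL : L.length < g.norm) : IsPre (FreeGroup.mk L * g) (FreeGroup.mk L * h) := by
  induction L with
  | nil => simpa [← FreeGroup.one_eq_mk] using H
  | cons s L ih =>
    have e : FreeGroup.mk (s :: L) = letter s * FreeGroup.mk L := by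
      rw [letter, FreeGroup.mul_mk]; rfl
    simp only [List.length_cons] at hL
    rw [e, mul_assoc, mul_assoc]
    refine (ih (by omega)).letter_mul ?_ s
    intro h1
    have h2 := norm_le_mul (FreeGroup.mk L) g
    have h3 := FreeGroup.norm_mk_le (L₁ := L)
    rw [h1, FreeGroup.norm_one] at h2
    omega

/-- Left translation by a short element preserves the prefix relation. -/
theorem IsPre.mul_left {g h : FreeGroup (Fin k)} (H : IsPre g h) (a : FreeGroup (Fin k))
    (ha : a.norm < g.norm) : IsPre (a * g) (a * h) := by
  rw [← FreeGroup.mk_toWord (x := a)]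
  exact H.mk_mul _ ha

end words

section extension

variable {k : ℕ}

/-- The condition under which `f` extends continuously to the boundary: each letter of `f g`
depends only on a sufficiently long initial segment of `g`. -/
def Extends (f : FreeGroup (Fin k) → FreeGroup (Fin k)) : Prop :=
  ∀ i : ℕ, ∃ N, ∀ g : FreeGroup (Fin k), N ≤ g.norm →
    ∃ c : Letter k, ∀ h, IsPre g h → (f h).toWord[i]? = some c

theorem extends_of_proper_lipschitz {f : FreeGroup (Fin k) → FreeGroup (Fin k)} (C : ℕ)
    (hC : ∀ g s, ((f g)⁻¹ * f (g * letter s)).norm ≤ C)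
    (hP : ∀ M, ∃ N, ∀ g, N ≤ g.norm → M ≤ (f g).norm) : Extends f := by
  intro i
  obtain ⟨N, hN⟩ := hP (i + C + 1)
  refine ⟨N, fun g hg => ?_⟩
  have hlen : i < (f g).toWord.length := by
    have := hN g hg
    simp only [FreeGroup.norm] at this
    omega
  refine ⟨(f g).toWord[i], ?_⟩
  rintro h ⟨L, hL⟩
  induction L using List.reverseRecOn generalizing h with
  | nil =>
    have : h = g := FreeGroup.toWord_injective (by simpa using hL.symm)
    rw [this, List.getElem?_eq_getElem hlen]
  | append_singleton L s ih =>
    have hred : FreeGroup.IsReduced (g.toWord ++ L) := by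
      refine (FreeGroup.isReduced_toWord (x := h)).infix ?_
      rw [← hL, ← List.append_assoc]
      exact (List.prefix_append _ _).isInfix
    have hw : (FreeGroup.mk (g.toWord ++ L)).toWord = g.toWord ++ L := by
      rw [FreeGroup.toWord_mk, hred.reduce_eq]
    have e : h = FreeGroup.mk (g.toWord ++ L) * letter s := by
      rw [letter, FreeGroup.mul_mk, List.append_assoc, hL, FreeGroup.mk_toWord]
    have h1 := ih (FreeGroup.mk (g.toWord ++ L)) hw.symm
    have h2 : i + C + 1 ≤ (f (FreeGroup.mk (g.toWord ++ L))).norm := by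
      apply hN
      have : g.norm ≤ (FreeGroup.mk (g.toWord ++ L)).norm := by
        simp only [FreeGroup.norm] at *
        rw [hw]; simp
      omega
    have h3 := hC (FreeGroup.mk (g.toWord ++ L)) s
    rw [← h1, e]
    have h4 := getElem?_mul (f (FreeGroup.mk (g.toWord ++ L)))
      ((f (FreeGroup.mk (g.toWord ++ L)))⁻¹ * f (FreeGroup.mk (g.toWord ++ L) * letter s))
      (i := i) (by omega)
    rwa [mul_inv_cancel_left] at h4

theorem extends_mul_left (a : FreeGroup (Fin k)) : Extends (fun g => a * g) := by
  refine extends_of_proper_lipschitz 1 ?_ ?_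
  · intro g s
    have : (a * g)⁻¹ * (a * (g * letter s)) = letter s := by group
    rw [this, norm_letter]
  · intro M
    refine ⟨M + a.norm, fun g hg => ?_⟩
    have := norm_le_mul a g
    omega

theorem exists_lipschitz (φ : MulAut (FreeGroup (Fin k))) :
    ∃ C : ℕ, (∀ s, (φ (letter s)).norm ≤ C) ∧ ∀ g, (φ g).norm ≤ C * g.norm := by
  obtain ⟨C, hC⟩ : ∃ C : ℕ, ∀ s, (φ (letter s)).norm ≤ C :=
    ⟨Finset.univ.sup fun s => (φ (letter s)).norm,
      fun s => Finset.le_sup (f := fun s => (φ (letter s)).norm) (Finset.mem_univ s)⟩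
  refine ⟨C, hC, ?_⟩
  have key : ∀ L : List (Letter k), (φ (FreeGroup.mk L)).norm ≤ C * L.length := by
    intro L
    induction L with
    | nil => simp [← FreeGroup.one_eq_mk]
    | cons s L ih =>
      have e : FreeGroup.mk (s :: L) = letter s * FreeGroup.mk L := by
        rw [letter, FreeGroup.mul_mk]; rfl
      rw [e, map_mul, List.length_cons, mul_add, mul_one]
      have := FreeGroup.norm_mul_le (φ (letter s)) (φ (FreeGroup.mk L))
      have := hC s
      omega
  intro g
  have := key g.toWord
  rwa [FreeGroup.mk_toWord] at this

theorem extends_aut (φ : MulAut (FreeGroup (Fin k))) : Extends φ := by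
  obtain ⟨C, hC, -⟩ := exists_lipschitz φ
  obtain ⟨D, -, hD⟩ := exists_lipschitz φ⁻¹
  refine extends_of_proper_lipschitz C ?_ ?_
  · intro g s
    rw [map_mul, inv_mul_cancel_left]
    exact hC s
  · intro M
    refine ⟨D * M + 1, fun g hg => ?_⟩
    have := hD (φ g)
    rw [MulAut.inv_apply_self] at this
    by_contra hlt
    have : D * (φ g).norm ≤ D * M := Nat.mul_le_mul_left _ (by omega)
    omega

variable {f : FreeGroup (Fin k) → FreeGroup (Fin k)}

theorem exists_convergesTo (hf : Extends f) (ω : Boundary k) :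
    ∃ ξ, ConvergesTo (fun n => f (pre ω n)) ξ := by
  have h : ∀ i : ℕ, ∃ c : Letter k, ∀ᶠ n in atTop, (f (pre ω n)).toWord[i]? = some c := by
    intro i
    obtain ⟨N, hN⟩ := hf i
    obtain ⟨c, hc⟩ := hN (pre ω N) (norm_pre ω N).ge
    refine ⟨c, ?_⟩
    filter_upwards [eventually_ge_atTop N] with n hn
    exact hc _ (pre_isPre ω hn)
  choose c hc using h
  refine ⟨⟨c, fun n => ?_⟩, hc⟩
  obtain ⟨m, h1, h2⟩ := ((hc n).and (hc (n + 1))).exists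
  have hr := FreeGroup.isReduced_toWord (x := f (pre ω m))
  rw [FreeGroup.IsReduced, List.isChain_iff_getElem] at hr
  obtain ⟨l1, e1⟩ := List.getElem?_eq_some_iff.1 h1
  obtain ⟨l2, e2⟩ := List.getElem?_eq_some_iff.1 h2
  have := hr n l2
  rwa [e1, e2] at this

theorem bdMap_spec (hf : Extends f) (ω : Boundary k) :
    ConvergesTo (fun n => f (pre ω n)) (bdMap f ω) := by
  have h := exists_convergesTo hf ω
  rw [bdMap, dif_pos h]
  exact h.choose_spec

theorem bdMap_letter (hf : Extends f) (i : ℕ) : ∃ N, ∀ (ω : Boundary k) g, IsPre (pre ω N) g →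
    (f g).toWord[i]? = some ((bdMap f ω).1 i) := by
  obtain ⟨N, hN⟩ := hf i
  refine ⟨N, fun ω g hg => ?_⟩
  obtain ⟨c, hc⟩ := hN (pre ω N) (norm_pre ω N).ge
  obtain ⟨n, h1, h2⟩ := ((bdMap_spec hf ω i).and (eventually_ge_atTop N)).exists
  rw [hc g hg, ← h1, hc _ (pre_isPre ω h2)]

theorem ConvergesTo.bdMap {u : ℕ → FreeGroup (Fin k)} {ω : Boundary k} (h : ConvergesTo u ω)
    (hf : Extends f) : ConvergesTo (fun n => f (u n)) (bdMap f ω) := by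
  intro i
  obtain ⟨N, hN⟩ := bdMap_letter hf i
  filter_upwards [convergesTo_iff.1 h N] with n hn
  exact hN ω _ hn

theorem bdMap_comp {f' : FreeGroup (Fin k) → FreeGroup (Fin k)} (hf : Extends f)
    (hf' : Extends f') (hc : Extends (f ∘ f')) (ω : Boundary k) :
    bdMap (f ∘ f') ω = bdMap f (bdMap f' ω) :=
  (bdMap_spec hc ω).unique ((bdMap_spec hf' ω).bdMap hf)

theorem bdMap_id (ω : Boundary k) : bdMap (fun g => g) ω = ω := by
  have h : ConvergesTo (fun n => (fun g => g) (pre ω n)) ω := convergesTo_pre ω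
  have hex : ∃ ξ, ConvergesTo (fun n => (fun g => g) (pre ω n)) ξ := ⟨ω, h⟩
  rw [bdMap, dif_pos hex]
  exact hex.choose_spec.unique h

theorem continuous_of_locally_pre {Y : Type*} [TopologicalSpace Y] (N : ℕ)
    (F : FreeGroup (Fin k) → Y) :
    Continuous fun ω : Boundary k => F (pre ω N) := by
  have h1 : Continuous fun ω : Boundary k => (fun j : Fin N => ω.1 j) :=
    continuous_pi fun j => (continuous_apply (j : ℕ)).comp continuous_subtype_val
  have h2 : (fun ω : Boundary k => F (pre ω N)) =
      (fun l : Fin N → Letter k => F (FreeGroup.mk (List.ofFn l))) ∘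
        (fun ω : Boundary k => (fun j : Fin N => ω.1 j)) := by
    funext ω
    simp only [pre, Function.comp]
    congr 2
    apply List.ext_getElem <;> simp
  rw [h2]
  exact (continuous_of_discreteTopology).comp h1

theorem continuous_bdMap (hf : Extends f) : Continuous (bdMap f) := by
  refine Continuous.subtype_mk (f := fun ω => (bdMap f ω).1) ?_ fun ω => (bdMap f ω).2
  refine continuous_pi fun i => ?_
  obtain ⟨N, hN⟩ := bdMap_letter hf i
  by_cases hne : Nonempty (Letter k)
  · obtain ⟨d⟩ := hne
    have : (fun ω : Boundary k => (bdMap f ω).1 i) =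
        fun ω => ((f (pre ω N)).toWord[i]?).getD d := by
      funext ω
      rw [hN ω _ (IsPre.refl _)]; rfl
    rw [this]
    exact continuous_of_locally_pre N fun g => ((f g).toWord[i]?).getD d
  · have : IsEmpty (Boundary k) := ⟨fun ω => hne ⟨ω.1 0⟩⟩
    exact continuous_of_const fun x => isEmptyElim x

end extension

/-- The action of `F` on `∂F` by left translations. -/
noncomputable instance (k : ℕ) : MulAction (FreeGroup (Fin k)) (Boundary k) where
  smul g ω := bdMap (fun h => g * h) ω
  one_smul ω := by
    change bdMap (fun h => 1 * h) ω = ω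
    simp only [one_mul]
    exact bdMap_id ω
  mul_smul g g' ω := by
    change bdMap (fun h => g * g' * h) ω = bdMap (fun h => g * h) (bdMap (fun h => g' * h) ω)
    rw [← bdMap_comp (extends_mul_left g) (extends_mul_left g')]
    · congr 1; funext h; exact mul_assoc _ _ _
    · convert extends_mul_left (g * g') using 1
      funext h; exact (mul_assoc _ _ _).symm

/-- The boundary homeomorphism `∂φ : ∂F → ∂F` of an automorphism `φ` of `F`. -/
noncomputable def bdHomeo {k : ℕ} (φ : MulAut (FreeGroup (Fin k))) : Boundary k ≃ₜ Boundary k where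
  toFun := bdMap φ
  invFun := bdMap (φ⁻¹ : MulAut (FreeGroup (Fin k)))
  left_inv ω := by
    have e : (⇑(φ⁻¹ : MulAut (FreeGroup (Fin k))) ∘ ⇑φ) = fun g => g := by
      funext g; exact MulAut.inv_apply_self _ φ g
    rw [← bdMap_comp (extends_aut _) (extends_aut _), e, bdMap_id]
    rw [e]
    simpa using extends_mul_left (1 : FreeGroup (Fin k))
  right_inv ω := by
    have e : (⇑φ ∘ ⇑(φ⁻¹ : MulAut (FreeGroup (Fin k)))) = fun g => g := by
      funext g; exact MulAut.apply_inv_self _ φ g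
    rw [← bdMap_comp (extends_aut _) (extends_aut _), e, bdMap_id]
    rw [e]
    simpa using extends_mul_left (1 : FreeGroup (Fin k))
  continuous_toFun := continuous_bdMap (extends_aut φ)
  continuous_invFun := continuous_bdMap (extends_aut φ⁻¹)

/-- `∂²F`: the space of ordered pairs of distinct points of `∂F`. -/
abbrev Boundary2 (k : ℕ) : Type := {p : Boundary k × Boundary k // p.1 ≠ p.2}

/-- The homeomorphism `∂²φ` of `∂²F` induced diagonally by `∂φ`. -/
noncomputable def bd2Homeo {k : ℕ} (φ : MulAut (FreeGroup (Fin k))) :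
    Boundary2 k ≃ₜ Boundary2 k :=
  ((bdHomeo φ).prodCongr (bdHomeo φ)).subtype fun _ => (bdHomeo φ).injective.ne_iff.symm

/-- The diagonal action of `F` on `∂²F` by left translations. -/
noncomputable instance (k : ℕ) : MulAction (FreeGroup (Fin k)) (Boundary2 k) where
  smul g p := ⟨(g • p.1.1, g • p.1.2), (MulAction.injective g).ne p.2⟩
  one_smul p := Subtype.ext (Prod.ext (one_smul _ p.1.1) (one_smul _ p.1.2))
  mul_smul g h p := Subtype.ext (Prod.ext (mul_smul g h p.1.1) (mul_smul g h p.1.2))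

/-- A (parametrized, bi-infinite) geodesic line in the Cayley graph `X` of `F` with respect to
`A`; the distance of `g, h ∈ VX = F` is `|g⁻¹ h|`. -/
def IsGeodesicLine {k : ℕ} (p : ℤ → FreeGroup (Fin k)) : Prop :=
  ∀ i j : ℤ, ((p i)⁻¹ * p j).norm = (i - j).natAbs

/-- The cylinder `Cyl_X([x, y])`: all `(ζ, ξ) ∈ ∂²F` such that the geodesic from `ζ` to `ξ` in the
Cayley graph passes through the segment from `x` to `y` in the correct direction. -/
def Cyl {k : ℕ} (x y : FreeGroup (Fin k)) : Set (Boundary2 k) :=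
  {q | ∃ p : ℤ → FreeGroup (Fin k), IsGeodesicLine p ∧
    ConvergesTo (fun n : ℕ => p (-n)) q.1.1 ∧ ConvergesTo (fun n : ℕ => p n) q.1.2 ∧
    ∃ i j : ℤ, i ≤ j ∧ p i = x ∧ p j = y}

/-- A geodesic current on `F`: an `F`-invariant, locally finite (that is, finite on compact
subsets; this is part of `Measure.Regular`) positive Radon measure on `∂²F`. -/
structure GeodesicCurrent (k : ℕ) where
  toMeasure : Measure (Boundary2 k)
  regular : toMeasure.Regular
  invariant : ∀ g : FreeGroup (Fin k), toMeasure.map (fun q => g • q) = toMeasure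

section lemmas

variable {k : ℕ}

theorem smul_def (g : FreeGroup (Fin k)) (ω : Boundary k) :
    g • ω = bdMap (fun h => g * h) ω := rfl

theorem ConvergesTo.smul {u : ℕ → FreeGroup (Fin k)} {ω : Boundary k} (h : ConvergesTo u ω)
    (g : FreeGroup (Fin k)) : ConvergesTo (fun n => g * u n) (g • ω) :=
  h.bdMap (extends_mul_left g)

instance : ContinuousConstSMul (FreeGroup (Fin k)) (Boundary k) :=
  ⟨fun g => continuous_bdMap (extends_mul_left g)⟩

instance : ContinuousConstSMul (FreeGroup (Fin k)) (Boundary2 k) :=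
  ⟨fun g => Continuous.subtype_mk
    (((continuous_const_smul g).comp (continuous_fst.comp continuous_subtype_val)).prodMk
      ((continuous_const_smul g).comp (continuous_snd.comp continuous_subtype_val))) _⟩

theorem bdHomeo_smul (φ : MulAut (FreeGroup (Fin k))) (g : FreeGroup (Fin k)) (ω : Boundary k) :
    bdHomeo φ (g • ω) = φ g • bdHomeo φ ω := by
  have h1 : ConvergesTo (fun n => φ (g * pre ω n)) (bdMap φ (g • ω)) :=
    ((convergesTo_pre ω).smul g).bdMap (extends_aut φ)
  have h2 : ConvergesTo (fun n => φ g * φ (pre ω n)) (φ g • bdMap φ ω) :=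
    ((convergesTo_pre ω).bdMap (extends_aut φ)).smul (φ g)
  simp only [map_mul] at h1
  exact h1.unique h2

theorem bdHomeo_mul (φ ψ : MulAut (FreeGroup (Fin k))) (ω : Boundary k) :
    bdHomeo (φ * ψ) ω = bdHomeo φ (bdHomeo ψ ω) :=
  bdMap_comp (extends_aut φ) (extends_aut ψ) (extends_aut (φ * ψ)) ω

theorem bdHomeo_one (ω : Boundary k) : bdHomeo (1 : MulAut (FreeGroup (Fin k))) ω = ω :=
  bdMap_id ω

theorem bd2Homeo_smul (φ : MulAut (FreeGroup (Fin k))) (g : FreeGroup (Fin k)) (q : Boundary2 k) :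
    bd2Homeo φ (g • q) = φ g • bd2Homeo φ q :=
  Subtype.ext (Prod.ext (bdHomeo_smul φ g q.1.1) (bdHomeo_smul φ g q.1.2))

theorem isClosed_boundary : IsClosed {ω : ℕ → Letter k |
    ∀ n, (ω n).1 = (ω (n + 1)).1 → (ω n).2 = (ω (n + 1)).2} := by
  have : {ω : ℕ → Letter k | ∀ n, (ω n).1 = (ω (n + 1)).1 → (ω n).2 = (ω (n + 1)).2} =
      ⋂ n, (fun ω : ℕ → Letter k => (ω n, ω (n + 1))) ⁻¹'
        {p | p.1.1 = p.2.1 → p.1.2 = p.2.2} := by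
    ext; simp
  rw [this]
  refine isClosed_iInter fun n => (isClosed_discrete _).preimage ?_
  exact (continuous_apply n).prodMk (continuous_apply (n + 1))

instance : CompactSpace (Boundary k) :=
  isCompact_iff_compactSpace.1 (isClosed_boundary (k := k)).isCompact

instance : T2Space (Boundary k) :=
  inferInstanceAs (T2Space
    {ω : ℕ → Letter k // ∀ n, (ω n).1 = (ω (n + 1)).1 → (ω n).2 = (ω (n + 1)).2})

instance : SecondCountableTopology (Boundary k) :=
  (Topology.IsEmbedding.subtypeVal (p := fun ω : ℕ → Letter k =>
    ∀ n, (ω n).1 = (ω (n + 1)).1 → (ω n).2 = (ω (n + 1)).2)).secondCountableTopology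

instance : SecondCountableTopology (Boundary2 k) :=
  Topology.IsEmbedding.subtypeVal.secondCountableTopology

theorem isOpen_offDiag : IsOpen {p : Boundary k × Boundary k | p.1 ≠ p.2} :=
  isOpen_ne_fun continuous_fst continuous_snd

instance : LocallyCompactSpace (Boundary2 k) := (isOpen_offDiag (k := k)).locallyCompactSpace


end lemmas

/-- The action of `Aut(F)` on currents: `(φν)(S) = ν((∂²φ)⁻¹(S))`. -/
noncomputable def GeodesicCurrent.act {k : ℕ} (φ : MulAut (FreeGroup (Fin k)))
    (ν : GeodesicCurrent k) : GeodesicCurrent k where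
  toMeasure := ν.toMeasure.map (bd2Homeo φ)
  regular := by
    have := ν.regular
    exact Measure.Regular.map (bd2Homeo φ)
  invariant g := by
    have hm : Measurable (bd2Homeo φ) := (bd2Homeo φ).continuous.measurable
    have hg : ∀ g : FreeGroup (Fin k), Measurable fun q : Boundary2 k => g • q :=
      fun g => (continuous_const_smul g).measurable
    rw [Measure.map_map (hg g) hm]
    have e : (fun q : Boundary2 k => g • q) ∘ bd2Homeo φ =
        bd2Homeo φ ∘ fun q => φ⁻¹ g • q := by
      funext q
      simp only [Function.comp, bd2Homeo_smul, MulAut.apply_inv_self]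
    rw [e, ← Measure.map_map hm (hg _), ν.invariant]

noncomputable instance (k : ℕ) : SMul (MulAut (FreeGroup (Fin k))) (GeodesicCurrent k) :=
  ⟨GeodesicCurrent.act⟩

/-- The number of occurrences `⟨v, ν⟩` of `v ∈ F` in the current `ν`: the `ν`-measure of
`Cyl_X(γ)` for the segment `γ = [1, v]` labelled by `v`. -/
noncomputable def GeodesicCurrent.occ {k : ℕ} (v : FreeGroup (Fin k)) (ν : GeodesicCurrent k) : ℝ :=
  ν.toMeasure.real (Cyl 1 v)

/-- The length `L(ν) = ∑_{a ∈ A ∪ A⁻¹} ⟨a, ν⟩` of a current. -/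
noncomputable def GeodesicCurrent.length {k : ℕ} (ν : GeodesicCurrent k) : ℝ :=
  ∑ a : Letter k, ν.occ (letter a)

/-- A Whitehead automorphism of the first kind (relabelling): it permutes `Σ`. -/
def IsRelabelling {k : ℕ} (τ : MulAut (FreeGroup (Fin k))) : Prop :=
  ∃ t : Equiv.Perm (Letter k), ∀ x, τ (letter x) = letter (t x)

/-- A Whitehead automorphism of the second kind, with multiplier `a ∈ Σ`. -/
def IsWhiteheadSecondKind {k : ℕ} (τ : MulAut (FreeGroup (Fin k))) : Prop :=
  ∃ a : Letter k, ∀ x : Letter k, τ (letter x) = letter x ∨ τ (letter x) = letter x * letter a ∨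
    τ (letter x) = (letter a)⁻¹ * letter x ∨ τ (letter x) = (letter a)⁻¹ * letter x * letter a

/-- An automorphism is simple if it is the composition of an inner and a relabelling
automorphism. -/
def IsSimple {k : ℕ} (φ : MulAut (FreeGroup (Fin k))) : Prop :=
  ∃ (g : FreeGroup (Fin k)) (ρ : MulAut (FreeGroup (Fin k))), IsRelabelling ρ ∧
    φ = MulAut.conj g * ρ

section cylinders

variable {k : ℕ}

theorem isPre_of_norm_add {g h : FreeGroup (Fin k)} (H : g.norm + h.norm ≤ (g * h).norm) :
    IsPre g (g * h) := by
  have h1 := FreeGroup.toWord_mul_sublist g h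
  have h2 : (g * h).toWord = g.toWord ++ h.toWord := by
    apply h1.eq_of_length_le
    simpa [FreeGroup.norm] using H
  exact ⟨h.toWord, h2.symm⟩

theorem IsPre.norm_inv_mul {g h : FreeGroup (Fin k)} (H : IsPre g h) :
    (g⁻¹ * h).norm = h.norm - g.norm := by
  obtain ⟨L, hL⟩ := H
  have hred : FreeGroup.IsReduced L := by
    refine (FreeGroup.isReduced_toWord (x := h)).infix ?_
    rw [← hL]; exact (List.suffix_append _ _).isInfix
  have e : g⁻¹ * h = FreeGroup.mk L := by
    rw [inv_mul_eq_iff_eq_mul]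
    conv_rhs => rw [← FreeGroup.mk_toWord (x := g), FreeGroup.mul_mk, hL]
    rw [FreeGroup.mk_toWord]
  rw [e, FreeGroup.norm, FreeGroup.toWord_mk, hred.reduce_eq, FreeGroup.norm, ← hL]
  simp [FreeGroup.norm]

theorem norm_inv_mul_of_ne {g h : FreeGroup (Fin k)} {P A B : List (Letter k)} {a b : Letter k}
    (hg : g.toWord = P ++ a :: A) (hh : h.toWord = P ++ b :: B) (hab : a ≠ b) :
    (g⁻¹ * h).norm = A.length + B.length + 2 := by
  have hA : FreeGroup.IsReduced (a :: A) := by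
    refine (FreeGroup.isReduced_toWord (x := g)).infix ?_
    rw [hg]; exact (List.suffix_append _ _).isInfix
  have hB : FreeGroup.IsReduced (b :: B) := by
    refine (FreeGroup.isReduced_toWord (x := h)).infix ?_
    rw [hh]; exact (List.suffix_append _ _).isInfix
  have e : g⁻¹ * h = FreeGroup.mk (FreeGroup.invRev (a :: A) ++ b :: B) := by
    rw [← FreeGroup.mk_toWord (x := g), ← FreeGroup.mk_toWord (x := h), hg, hh,
      ← FreeGroup.mul_mk, ← FreeGroup.mul_mk, ← FreeGroup.mul_mk, ← FreeGroup.inv_mk]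
    group
  have hA' : FreeGroup.IsReduced (FreeGroup.invRev (a :: A)) := by
    rw [FreeGroup.isReduced_iff_reduce_eq, FreeGroup.reduce_invRev, hA.reduce_eq]
  have hiA : FreeGroup.invRev (a :: A) = FreeGroup.invRev A ++ [(a.1, !a.2)] := by
    simp [FreeGroup.invRev]
  have hred : FreeGroup.IsReduced (FreeGroup.invRev (a :: A) ++ b :: B) := by
    rw [hiA] at hA' ⊢
    have h2 : FreeGroup.IsReduced ([(a.1, !a.2)] ++ b :: B) := by
      simp only [List.singleton_append, FreeGroup.isReduced_cons_cons]
      refine ⟨fun h1 => ?_, hB⟩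
      by_contra h2
      refine hab (Prod.ext h1 ?_)
      cases h3 : a.2 <;> cases h4 : b.2 <;> simp_all
    exact FreeGroup.IsReduced.append_overlap hA' h2 (by simp)
  rw [e, FreeGroup.norm, FreeGroup.toWord_mk, hred.reduce_eq]
  simp [FreeGroup.invRev_length]; omega

theorem toWord_pre_succ (ω : Boundary k) (n : ℕ) :
    (pre ω (n + 1)).toWord = [] ++ ω.1 0 :: (List.range n).map (fun i => ω.1 (i + 1)) := by
  rw [toWord_pre, List.range_succ_eq_map]
  simp [Function.comp_def]

theorem norm_pre_inv_mul_pre {ζ ξ : Boundary k} (h : ζ.1 0 ≠ ξ.1 0) (m n : ℕ) :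
    ((pre ζ m)⁻¹ * pre ξ n).norm = m + n := by
  have h0 : ∀ ω : Boundary k, pre ω 0 = 1 := fun ω => by simp [pre, ← FreeGroup.one_eq_mk]
  rcases m with _ | m
  · simp [h0, norm_pre]
  rcases n with _ | n
  · simp [h0, norm_pre]
  rw [norm_inv_mul_of_ne (toWord_pre_succ ζ m) (toWord_pre_succ ξ n) h]
  simp; omega

theorem IsGeodesicLine.pre_eq {p : ℤ → FreeGroup (Fin k)} (hp : IsGeodesicLine p)
    {ξ : Boundary k} (h : ConvergesTo (fun n : ℕ => p n) ξ) (i : ℤ) (n : ℕ) :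
    pre ((p i)⁻¹ • ξ) n = (p i)⁻¹ * p (i + n) := by
  have h1 := convergesTo_iff.1 (h.smul (p i)⁻¹) n
  obtain ⟨m, hm, hm'⟩ := (h1.and (eventually_ge_atTop (i + n).toNat)).exists
  have hn : ((p i)⁻¹ * p (i + n)).norm = n := by rw [hp]; omega
  have h2 : IsPre ((p i)⁻¹ * p (i + n)) ((p i)⁻¹ * p m) := by
    have e : (p i)⁻¹ * p m = (p i)⁻¹ * p (i + n) * ((p (i + n))⁻¹ * p m) := by group
    rw [e]
    apply isPre_of_norm_add
    rw [← e, hp, hp, hp]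
    omega
  exact (hm.of_le h2 (by rw [norm_pre, hn])).eq_of_norm (by rw [norm_pre, hn])

theorem mem_cyl_iff (x y : FreeGroup (Fin k)) (q : Boundary2 k) : q ∈ Cyl x y ↔
    (x⁻¹ • q.1.1).1 0 ≠ (x⁻¹ • q.1.2).1 0 ∧ pre (x⁻¹ • q.1.2) (x⁻¹ * y).norm = x⁻¹ * y := by
  constructor
  · rintro ⟨p, hp, hζ, hξ, i, j, hij, rfl, rfl⟩
    have h1 := hp.pre_eq hξ i
    have hp' : IsGeodesicLine fun n => p (-n) := fun a b => by rw [hp]; omega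
    have h2 := hp'.pre_eq hζ (-i)
    simp only [neg_neg, neg_add_rev] at h2
    refine ⟨fun h0 => ?_, ?_⟩
    · have e : pre ((p i)⁻¹ • q.1.1) 1 = pre ((p i)⁻¹ • q.1.2) 1 := by
        simp [pre, h0]
      rw [h1, h2] at e
      have e' := mul_left_cancel e
      have := hp (-((1 : ℕ) : ℤ) + i) (i + (1 : ℕ))
      rw [e', inv_mul_cancel, FreeGroup.norm_one] at this
      omega
    · obtain ⟨n, rfl⟩ := Int.le.dest hij
      rw [hp, h1]
      congr 3
      omega
  · rintro ⟨h0, h1⟩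
    set ζ := x⁻¹ • q.1.1 with hζ
    set ξ := x⁻¹ • q.1.2 with hξ
    have p0 : ∀ ω : Boundary k, pre ω 0 = 1 := fun ω => by simp [pre, ← FreeGroup.one_eq_mk]
    have hG : ∀ (ω : Boundary k) (m n : ℕ), m ≤ n →
        ((pre ω m)⁻¹ * pre ω n).norm = n - m := fun ω m n h => by
      rw [(pre_isPre ω h).norm_inv_mul, norm_pre, norm_pre]
    have hG' : ∀ (ω : Boundary k) (m n : ℕ), n ≤ m →
        ((pre ω m)⁻¹ * pre ω n).norm = m - n := fun ω m n h => by
      rw [← FreeGroup.norm_inv_eq, mul_inv_rev, inv_inv, hG ω n m h]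
    refine ⟨fun n => x * if 0 ≤ n then pre ξ n.toNat else pre ζ (-n).toNat, ?_, ?_, ?_,
      0, (x⁻¹ * y).norm, by positivity, ?_, ?_⟩
    · intro i j
      have e : ∀ a b : FreeGroup (Fin k), (x * a)⁻¹ * (x * b) = a⁻¹ * b := fun a b => by group
      simp only [e]
      split_ifs with hi hj hj
      · rcases le_total i j with h | h
        · rw [hG _ _ _ (by omega)]; omega
        · rw [hG' _ _ _ (by omega)]; omega
      · rw [norm_pre_inv_mul_pre h0.symm]; omega
      · rw [norm_pre_inv_mul_pre h0]; omega
      · rcases le_total i j with h | h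
        · rw [hG' _ _ _ (by omega)]; omega
        · rw [hG _ _ _ (by omega)]; omega
    · have h2 := (convergesTo_pre ζ).smul x
      rw [hζ, smul_inv_smul, ← hζ] at h2
      convert h2 using 2 with n
      by_cases hn : n = 0
      · subst hn; simp [p0]
      · beta_reduce; rw [if_neg (by omega)]; simp
    · have h2 := (convergesTo_pre ξ).smul x
      rw [hξ, smul_inv_smul, ← hξ] at h2
      convert h2 using 2 with n
      simp
    · simp [p0]
    · simp [h1]

end cylinders

section measures

variable {k : ℕ}

/-- The set of all rays in `∂F` that begin with `v`. -/
def shadow (v : FreeGroup (Fin k)) : Set (Boundary k) := {ω | pre ω v.norm = v}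

theorem mem_shadow_iff {v : FreeGroup (Fin k)} {ω : Boundary k} {n : ℕ} (h : v.norm ≤ n) :
    ω ∈ shadow v ↔ IsPre v (pre ω n) := by
  constructor
  · intro H
    have := pre_isPre ω h
    rwa [show pre ω v.norm = v from H] at this
  · intro H
    exact ((pre_isPre ω h).of_le H (norm_pre _ _).le).eq_of_norm (norm_pre _ _).ge

theorem isClopen_shadow (v : FreeGroup (Fin k)) : IsClopen (shadow v) := by
  have h2 := continuous_of_locally_pre (k := k) (Y := Bool) v.norm (fun g => decide (g = v))
  have e : shadow v = (fun ω : Boundary k => decide (pre ω v.norm = v)) ⁻¹' {true} := by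
    ext; simp [shadow]
  rw [e]
  exact (isClopen_discrete _).preimage h2

theorem isOpen_shadow (v : FreeGroup (Fin k)) : IsOpen (shadow v) := (isClopen_shadow v).isOpen

theorem exists_shadow_subset {ω : Boundary k} {U : Set (Boundary k)} (hU : U ∈ 𝓝 ω) :
    ∃ N, ∀ n, N ≤ n → shadow (pre ω n) ⊆ U := by
  obtain ⟨V, hV, hVU⟩ := mem_nhds_induced _ _ _ |>.1 hU
  obtain ⟨-, ⟨x, n, rfl⟩, hx, hsub⟩ :=
    (PiNat.isTopologicalBasis_cylinders (fun _ : ℕ => Letter k)).mem_nhds_iff.1 hV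
  refine ⟨n, fun m hm ξ hξ => hVU (hsub ?_)⟩
  have e : pre ξ m = pre ω m := by simpa [shadow, norm_pre] using hξ
  intro i hi
  rw [← hx i hi]
  have h1 := getElem?_pre (ω := ξ) (hi.trans_le hm)
  rw [e, getElem?_pre (hi.trans_le hm)] at h1
  exact (Option.some_injective _ h1).symm

/-- The product set of two shadows inside `∂²F`. -/
def rect (u v : FreeGroup (Fin k)) : Set (Boundary2 k) :=
  {q | q.1.1 ∈ shadow u ∧ q.1.2 ∈ shadow v}

theorem isOpen_rect (u v : FreeGroup (Fin k)) : IsOpen (rect u v) :=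
  ((isOpen_shadow u).preimage (continuous_fst.comp continuous_subtype_val)).inter
    ((isOpen_shadow v).preimage (continuous_snd.comp continuous_subtype_val))

/-- Product sets of shadows of distinct elements of the same length `> N`. -/
def rects (k N : ℕ) : Set (Set (Boundary2 k)) :=
  {R | ∃ u v : FreeGroup (Fin k), u ≠ v ∧ u.norm = v.norm ∧ N < u.norm ∧ R = rect u v}

theorem exists_pre_ne (q : Boundary2 k) : ∃ N, ∀ n, N ≤ n → pre q.1.1 n ≠ pre q.1.2 n := by
  by_contra! H
  refine q.2 (Subtype.ext (funext fun i => ?_))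
  obtain ⟨n, hn, e⟩ := H (i + 1)
  have h1 := getElem?_pre (ω := q.1.1) (show i < n by omega)
  rw [e, getElem?_pre (show i < n by omega)] at h1
  exact (Option.some_injective _ h1).symm

theorem isTopologicalBasis_rects (k N : ℕ) :
    TopologicalSpace.IsTopologicalBasis (rects k N) := by
  refine TopologicalSpace.isTopologicalBasis_of_isOpen_of_nhds ?_ ?_
  · rintro _ ⟨u, v, -, -, -, rfl⟩
    exact isOpen_rect u v
  · intro q U hq hU
    obtain ⟨V, hV, hVU⟩ := mem_nhds_induced _ _ _ |>.1 (hU.mem_nhds hq)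
    obtain ⟨A, hA, B, hB, hAB⟩ := mem_nhds_prod_iff.1 hV
    obtain ⟨a, ha⟩ := exists_shadow_subset hA
    obtain ⟨b, hb⟩ := exists_shadow_subset hB
    obtain ⟨c, hc⟩ := exists_pre_ne q
    let n := a + b + c + N + 1
    refine ⟨rect (pre q.1.1 n) (pre q.1.2 n), ⟨_, _, hc n (by omega), by simp [norm_pre], ?_, rfl⟩,
      ?_, ?_⟩
    · rw [norm_pre]; omega
    · constructor <;> simp [shadow, norm_pre]
    · rintro q' ⟨h1, h2⟩
      exact hVU (hAB ⟨ha n (by omega) h1, hb n (by omega) h2⟩)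

theorem isPiSystem_rects (k N : ℕ) : IsPiSystem (rects k N) := by
  have key : ∀ u v u' v' : FreeGroup (Fin k), u.norm = v.norm → u'.norm = v'.norm →
      u.norm ≤ u'.norm → (rect u v ∩ rect u' v').Nonempty →
      rect u v ∩ rect u' v' = rect u' v' := by
    rintro u v u' v' e e' hle ⟨q, ⟨h1, h2⟩, h3, h4⟩
    rw [Set.inter_eq_right]
    have hu : IsPre u u' := by
      have := (mem_shadow_iff hle).1 h1
      rwa [show pre q.1.1 u'.norm = u' from h3] at this
    have hv : IsPre v v' := by
      have := (mem_shadow_iff (n := v'.norm) (by omega)).1 h2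
      rwa [show pre q.1.2 v'.norm = v' from h4] at this
    rintro r ⟨h5, h6⟩
    exact ⟨(mem_shadow_iff hle).2 (hu.trans ((mem_shadow_iff le_rfl).1 h5)),
      (mem_shadow_iff (n := v'.norm) (by omega)).2 (hv.trans ((mem_shadow_iff le_rfl).1 h6))⟩
  rintro _ ⟨u, v, hne, e, hN, rfl⟩ _ ⟨u', v', hne', e', hN', rfl⟩ hnon
  rcases le_total u.norm u'.norm with h | h
  · rw [key u v u' v' e e' h hnon]
    exact ⟨u', v', hne', e', hN', rfl⟩
  · rw [Set.inter_comm] at hnon ⊢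
    rw [key u' v' u v e' e h hnon]
    exact ⟨u, v, hne, e, hN, rfl⟩

theorem ext_of_rects {μ ν : Measure (Boundary2 k)} (N : ℕ)
    (hfin : ∀ R ∈ rects k N, μ R ≠ ∞) (h : ∀ R ∈ rects k N, μ R = ν R) : μ = ν := by
  have hc : (rects k N).Countable := by
    have : Countable (FreeGroup (Fin k)) := FreeGroup.toWord_injective.countable
    refine (Set.countable_range fun p : FreeGroup (Fin k) × FreeGroup (Fin k) =>
      rect p.1 p.2).mono ?_
    rintro _ ⟨u, v, -, -, -, rfl⟩
    exact ⟨(u, v), rfl⟩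
  refine Measure.ext_of_generateFrom_of_cover_subset (S := rects k N) (T := rects k N) ?_
    (isPiSystem_rects k N) subset_rfl hc (isTopologicalBasis_rects k N).sUnion_eq hfin h
  rw [← (isTopologicalBasis_rects k N).borel_eq_generateFrom]
  exact BorelSpace.measurable_eq

theorem smul_shadow (g : FreeGroup (Fin k)) {w : FreeGroup (Fin k)} (hw : 2 * g.norm < w.norm)
    (ω : Boundary k) : g • ω ∈ shadow w ↔ ω ∈ shadow (g⁻¹ * w) := by
  have key : ∀ (a u : FreeGroup (Fin k)) (ξ : Boundary k), a.norm < u.norm → ξ ∈ shadow u →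
      a • ξ ∈ shadow (a * u) := by
    intro a u ξ h hξ
    have h1 := convergesTo_iff.1 ((convergesTo_pre ξ).smul a) (a * u).norm
    obtain ⟨n, hn, hn'⟩ := (h1.and (eventually_ge_atTop u.norm)).exists
    have h2 := ((mem_shadow_iff hn').1 hξ).mul_left a h
    exact (hn.of_le h2 (norm_pre _ _).le).eq_of_norm (norm_pre _ _).ge
  have hn : g.norm < (g⁻¹ * w).norm := by
    have := norm_le_mul g⁻¹ w
    rw [FreeGroup.norm_inv_eq] at this
    omega
  constructor
  · intro h
    have := key g⁻¹ w (g • ω) (by rw [FreeGroup.norm_inv_eq]; omega) h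
    rwa [inv_smul_smul] at this
  · intro h
    have := key g (g⁻¹ * w) ω hn h
    rwa [mul_inv_cancel_left] at this

end measures

section uniform

variable {k : ℕ}

theorem isCompact_cyl (x y : FreeGroup (Fin k)) : IsCompact (Cyl x y) := by
  have hs : Continuous fun ω : Boundary k => x⁻¹ • ω := continuous_const_smul _
  have h0 : Continuous fun ω : Boundary k => (x⁻¹ • ω).1 0 :=
    (continuous_apply 0).comp (continuous_subtype_val.comp hs)
  have hcl : IsClosed {p : Boundary k × Boundary k | (x⁻¹ • p.1).1 0 ≠ (x⁻¹ • p.2).1 0 ∧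
      x⁻¹ • p.2 ∈ shadow (x⁻¹ * y)} :=
    ((isClosed_discrete {l : Letter k × Letter k | l.1 ≠ l.2}).preimage
      ((h0.comp continuous_fst).prodMk (h0.comp continuous_snd))).inter
      ((isClopen_shadow _).isClosed.preimage (hs.comp continuous_snd))
  rw [Subtype.isCompact_iff]
  convert hcl.isCompact using 1
  ext p
  constructor
  · rintro ⟨q, hq, rfl⟩
    exact (mem_cyl_iff x y q).1 hq
  · intro hp
    exact ⟨⟨p, fun e => hp.1 (by rw [e])⟩, (mem_cyl_iff x y _).2 hp, rfl⟩

/-- The letters which may follow the letter `s` in a reduced word, enumerated. -/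
noncomputable def nextLetter (s : Letter k) :
    Fin (2 * k - 1) ≃ {t : Letter k // s.1 = t.1 → s.2 = t.2} :=
  (Fintype.equivFinOfCardEq (by
    have h : Fintype.card {t : Letter k // ¬ (s.1 = t.1 → s.2 = t.2)} = 1 := by
      rw [Fintype.card_eq_one_iff]
      refine ⟨⟨(s.1, !s.2), by simp⟩, ?_⟩
      rintro ⟨t, ht⟩
      push Not at ht
      refine Subtype.ext (Prod.ext ht.1.symm ?_)
      simp only
      exact Bool.eq_not.2 ht.2.symm
    have h2 := Fintype.card_subtype_compl fun t : Letter k => (s.1 = t.1 → s.2 = t.2)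
    have h3 := Fintype.card_subtype_le fun t : Letter k => (s.1 = t.1 → s.2 = t.2)
    have h4 : Fintype.card (Letter k) = 2 * k := by simp [mul_comm]
    have h5 : 0 < k := s.1.pos
    omega)).symm

/-- The infinite word starting with `x` whose further letters are chosen according to `d`. -/
noncomputable def walk (x : Letter k) (d : ℕ → Fin (2 * k - 1)) : ℕ → Letter k
  | 0 => x
  | n + 1 => nextLetter (walk x d n) (d n)

/-- The infinite word `walk x d` as a boundary point. -/
noncomputable def bdWalk (x : Letter k) (d : ℕ → Fin (2 * k - 1)) : Boundary k :=
  ⟨walk x d, fun n => (nextLetter (walk x d n) (d n)).2⟩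

theorem continuous_bdWalk (x : Letter k) : Continuous (bdWalk x) := by
  refine Continuous.subtype_mk (f := walk x) (continuous_pi fun n => ?_)
    fun d n => (nextLetter (walk x d n) (d n)).2
  induction n with
  | zero => exact continuous_const
  | succ n ih =>
    obtain ⟨f, hf⟩ : ∃ f : Letter k × Fin (2 * k - 1) → Letter k,
        ∀ s j, (nextLetter s j : Letter k) = f (s, j) :=
      ⟨fun p => nextLetter p.1 p.2, fun _ _ => rfl⟩
    have h' : Continuous fun d : ℕ → Fin (2 * k - 1) => (walk x d n, d n) :=
      ih.prodMk (continuous_apply n)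
    simp only [walk, hf]
    exact (continuous_of_discreteTopology (f := f)).comp h'

/-- The law of a sequence of independent uniformly distributed choices. -/
noncomputable def choices (k : ℕ) : Measure (ℕ → Fin (2 * k - 1)) :=
  Measure.infinitePi fun _ => ProbabilityTheory.uniformOn Set.univ

/-- The uniform measure `m_A` on `∂F`. -/
noncomputable def mA (k : ℕ) : Measure (Boundary k) :=
  ∑ x : Letter k, ((2 * k : ℕ) : ℝ≥0∞)⁻¹ • (choices k).map (bdWalk x)

theorem measurable_bdWalk (x : Letter k) : Measurable (bdWalk x) :=
  (continuous_bdWalk x).measurable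

theorem choices_preimage (hk : 2 ≤ k) {x : Letter k} {L : List (Letter k)}
    (h : FreeGroup.IsReduced (x :: L)) :
    choices k (bdWalk x ⁻¹' shadow (FreeGroup.mk (x :: L))) =
      ((2 * k - 1 : ℕ) : ℝ≥0∞)⁻¹ ^ L.length := by
  have : Nonempty (Fin (2 * k - 1)) := ⟨⟨0, by omega⟩⟩
  have hprob : IsProbabilityMeasure
      (ProbabilityTheory.uniformOn (Set.univ : Set (Fin (2 * k - 1)))) :=
    ProbabilityTheory.isProbabilityMeasure_uniformOn Set.finite_univ Set.univ_nonempty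
  have hex : ∀ i, ∃ c : Fin (2 * k - 1), ∀ hi : i < L.length,
      (nextLetter ((x :: L)[i]'(by simp; omega)) c : Letter k) = L[i] := by
    intro i
    by_cases hi : i < L.length
    · have hr := h
      rw [FreeGroup.IsReduced, List.isChain_iff_getElem] at hr
      have := hr i (by simpa using hi)
      refine ⟨(nextLetter _).symm ⟨L[i], this⟩, fun _ => ?_⟩
      simp
    · exact ⟨⟨0, by omega⟩, fun hi' => absurd hi' hi⟩
  choose c hc using hex
  have hmem : ∀ d, bdWalk x d ∈ shadow (FreeGroup.mk (x :: L)) ↔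
      ∀ i, ∀ hi : i < (x :: L).length, walk x d i = (x :: L)[i] := by
    intro d
    have hnorm : (FreeGroup.mk (x :: L)).norm = (x :: L).length := by
      rw [FreeGroup.norm, FreeGroup.toWord_mk, h.reduce_eq]
    rw [shadow, Set.mem_ofPred_eq, hnorm, ← FreeGroup.toWord_inj, toWord_pre, FreeGroup.toWord_mk,
      h.reduce_eq]
    constructor
    · intro e i hi
      have : ((List.range (x :: L).length).map (bdWalk x d).1)[i]? = (x :: L)[i]? := by rw [e]
      rw [List.getElem?_eq_getElem hi, List.getElem?_eq_getElem (by simpa using hi)] at this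
      simpa [bdWalk] using this
    · intro H
      apply List.ext_getElem (by simp)
      intro i h1 h2
      simp only [List.getElem_map, List.getElem_range]
      exact H i h2
  have hset : bdWalk x ⁻¹' shadow (FreeGroup.mk (x :: L)) =
      Set.pi (Finset.range L.length : Set ℕ) fun i => {c i} := by
    ext d
    simp only [Set.mem_preimage, hmem, Set.mem_pi, Finset.coe_range, Set.mem_Iio,
      Set.mem_singleton_iff]
    constructor
    · intro H i hi
      have h1 := H i (by simp; omega)
      have h2 := H (i + 1) (by simpa using hi)
      have h3 := hc i hi
      rw [walk, h1, List.getElem_cons_succ, ← h3] at h2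
      exact (nextLetter _).injective (Subtype.ext h2)
    · intro H i
      induction i with
      | zero => intro _; rfl
      | succ i ih =>
        intro hi
        have hi' : i < L.length := by simpa using hi
        rw [walk, ih (by omega), List.getElem_cons_succ, H i hi', hc i hi']
  rw [hset, choices, Measure.infinitePi_pi _ (fun i _ => MeasurableSet.singleton _)]
  have h1 : ∀ a : Fin (2 * k - 1), ProbabilityTheory.uniformOn Set.univ {a} =
      ((2 * k - 1 : ℕ) : ℝ≥0∞)⁻¹ := by
    intro a
    rw [ProbabilityTheory.uniformOn_univ]
    simp
  simp [h1]

theorem mA_shadow (hk : 2 ≤ k) {u : FreeGroup (Fin k)} (hu : u ≠ 1) :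
    mA k (shadow u) = ((2 * k : ℕ) : ℝ≥0∞)⁻¹ * ((2 * k - 1 : ℕ) : ℝ≥0∞)⁻¹ ^ (u.norm - 1) := by
  obtain ⟨x, L, hL⟩ := List.exists_cons_of_ne_nil (l := u.toWord) (by simpa using hu)
  have hred : FreeGroup.IsReduced (x :: L) := by rw [← hL]; exact FreeGroup.isReduced_toWord
  have e : u = FreeGroup.mk (x :: L) := by rw [← hL, FreeGroup.mk_toWord]
  have hm : MeasurableSet (shadow u) := (isOpen_shadow u).measurableSet
  simp only [mA, Measure.coe_finsetSum, Finset.sum_apply, Measure.smul_apply, smul_eq_mul]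
  rw [Finset.sum_eq_single x]
  · rw [Measure.map_apply (measurable_bdWalk x) hm, e, choices_preimage hk hred, ← e]
    simp [FreeGroup.norm, hL]
  · intro y _ hy
    rw [Measure.map_apply (measurable_bdWalk y) hm]
    have : bdWalk y ⁻¹' shadow u = ∅ := by
      ext d
      simp only [Set.mem_preimage, Set.mem_empty_iff_false, iff_false]
      intro h
      have h1 := getElem?_pre (ω := bdWalk y d) (n := u.norm) (i := 0)
        (by simp [FreeGroup.norm, hL])
      rw [show pre (bdWalk y d) u.norm = u from h, hL] at h1
      simp only [List.getElem?_cons_zero, Option.some.injEq] at h1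
      exact hy h1.symm
    rw [this]; simp
  · simp

theorem isFiniteMeasure_mA (hk : 2 ≤ k) : IsFiniteMeasure (mA k) := by
  have : Nonempty (Fin (2 * k - 1)) := ⟨⟨0, by omega⟩⟩
  have hprob : IsProbabilityMeasure
      (ProbabilityTheory.uniformOn (Set.univ : Set (Fin (2 * k - 1)))) :=
    ProbabilityTheory.isProbabilityMeasure_uniformOn Set.finite_univ Set.univ_nonempty
  have hp : IsProbabilityMeasure (choices k) := by unfold choices; infer_instance
  refine ⟨?_⟩
  simp only [mA, Measure.coe_finsetSum, Finset.sum_apply, Measure.smul_apply, smul_eq_mul]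
  refine ENNReal.sum_lt_top.2 fun x _ => ENNReal.mul_lt_top ?_ (measure_lt_top _ _)
  exact ENNReal.inv_lt_top.2 (by simp; omega)

/-- The measure `(2k/(2k-1)) (2k-1)^{2 (ζ|ξ)} dm_A(ζ) dm_A(ξ)` on `∂²F`, where `(ζ|ξ)` is the
length of the longest common initial segment. -/
noncomputable def nA (k : ℕ) : Measure (Boundary2 k) :=
  (((mA k).prod (mA k)).withDensity fun p =>
    ((2 * k : ℕ) : ℝ≥0∞) * ((2 * k - 1 : ℕ) : ℝ≥0∞)⁻¹ *
      ((2 * k - 1 : ℕ) : ℝ≥0∞) ^ (2 * PiNat.firstDiff p.1.1 p.2.1)).comap Subtype.val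

theorem exists_split {u v : FreeGroup (Fin k)} (h : ¬ IsPre u v) (h' : ¬ IsPre v u) :
    ∃ (P A B : List (Letter k)) (a b : Letter k), u.toWord = P ++ a :: A ∧
      v.toWord = P ++ b :: B ∧ a ≠ b := by
  have key : ∀ U V : List (Letter k), ¬ U <+: V → ¬ V <+: U →
      ∃ (P A B : List (Letter k)) (a b : Letter k), U = P ++ a :: A ∧ V = P ++ b :: B ∧ a ≠ b := by
    intro U
    induction U with
    | nil => intro V h; simp at h
    | cons a A ih =>
      intro V h h'
      rcases V with _ | ⟨b, B⟩
      · simp at h'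
      by_cases hab : a = b
      · subst hab
        obtain ⟨P, A', B', a', b', e1, e2, e3⟩ := ih B (by simpa using h) (by simpa using h')
        exact ⟨a :: P, A', B', a', b', by simp [e1], by simp [e2], e3⟩
      · exact ⟨[], A, B, a, b, rfl, rfl, hab⟩
  exact key _ _ h h'

theorem nA_rect (hk : 2 ≤ k) {u v : FreeGroup (Fin k)} (h : ¬ IsPre u v) (h' : ¬ IsPre v u) :
    nA k (rect u v) =
      ((2 * k : ℕ) : ℝ≥0∞)⁻¹ * ((2 * k - 1 : ℕ) : ℝ≥0∞)⁻¹ ^ ((u⁻¹ * v).norm - 1) := by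
  obtain ⟨P, A, B, a, b, hu, hv, hab⟩ := exists_split h h'
  have hl : ∀ ζ ∈ shadow u, ∀ ξ ∈ shadow v, ζ ≠ ξ ∧ PiNat.firstDiff ζ.1 ξ.1 = P.length := by
    intro ζ hζ ξ hξ
    have e1 : ∀ i < u.norm, ζ.1 i = (u.toWord[i]?).getD a := by
      intro i hi
      have := getElem?_pre (ω := ζ) hi
      rw [show pre ζ u.norm = u from hζ] at this
      rw [this]; rfl
    have e2 : ∀ i < v.norm, ξ.1 i = (v.toWord[i]?).getD a := by
      intro i hi
      have := getElem?_pre (ω := ξ) hi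
      rw [show pre ξ v.norm = v from hξ] at this
      rw [this]; rfl
    have nu : u.norm = P.length + A.length + 1 := by simp [FreeGroup.norm, hu]; omega
    have nv : v.norm = P.length + B.length + 1 := by simp [FreeGroup.norm, hv]; omega
    have hne : ζ.1 P.length ≠ ξ.1 P.length := by
      rw [e1 _ (by omega), e2 _ (by omega), hu, hv]
      simpa using hab
    have heq : ∀ i < P.length, ζ.1 i = ξ.1 i := by
      intro i hi
      rw [e1 _ (by omega), e2 _ (by omega), hu, hv, List.getElem?_append_left hi,
        List.getElem?_append_left hi]
    have hne' : ζ.1 ≠ ξ.1 := fun e => hne (by rw [e])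
    refine ⟨fun e => hne' (by rw [e]), ?_⟩
    apply le_antisymm
    · by_contra hlt
      exact hne (PiNat.apply_eq_of_lt_firstDiff (not_le.1 hlt))
    · by_contra hlt
      exact PiNat.apply_firstDiff_ne hne' (heq _ (not_le.1 hlt))
  have hme : MeasurableEmbedding (Subtype.val : Boundary2 k → Boundary k × Boundary k) :=
    MeasurableEmbedding.subtype_coe (s := {p : Boundary k × Boundary k | p.1 ≠ p.2})
      isOpen_offDiag.measurableSet
  have himg : (Subtype.val : Boundary2 k → _) '' rect u v = shadow u ×ˢ shadow v := by
    ext ⟨ζ, ξ⟩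
    constructor
    · rintro ⟨q, hq, e⟩
      rw [← e]; exact hq
    · rintro ⟨h1, h2⟩
      exact ⟨⟨(ζ, ξ), (hl ζ h1 ξ h2).1⟩, ⟨h1, h2⟩, rfl⟩
  have hms : MeasurableSet (shadow u ×ˢ shadow v) :=
    (isOpen_shadow u).measurableSet.prod (isOpen_shadow v).measurableSet
  have hu1 : u ≠ 1 := by rintro rfl; simp at hu
  have hv1 : v ≠ 1 := by rintro rfl; simp at hv
  have := isFiniteMeasure_mA hk
  rw [nA, hme.comap_apply, himg, withDensity_apply _ hms,
    setLIntegral_congr_fun (g := fun _ => ((2 * k : ℕ) : ℝ≥0∞) * ((2 * k - 1 : ℕ) : ℝ≥0∞)⁻¹ *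
      ((2 * k - 1 : ℕ) : ℝ≥0∞) ^ (2 * P.length)) hms
      (fun p hp => by rw [(hl p.1 hp.1 p.2 hp.2).2]),
    setLIntegral_const, Measure.prod_prod, mA_shadow hk hu1, mA_shadow hk hv1,
    norm_inv_mul_of_ne hu hv hab]
  have nu : u.norm - 1 = P.length + A.length := by simp [FreeGroup.norm, hu]
  have nv : v.norm - 1 = P.length + B.length := by simp [FreeGroup.norm, hv]
  rw [nu, nv, show A.length + B.length + 2 - 1 = A.length + B.length + 1 by omega]
  have c1 : ((2 * k : ℕ) : ℝ≥0∞) * ((2 * k : ℕ) : ℝ≥0∞)⁻¹ = 1 :=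
    ENNReal.mul_inv_cancel (by simp; omega) (ENNReal.natCast_ne_top _)
  have c2 : ((2 * k - 1 : ℕ) : ℝ≥0∞) * ((2 * k - 1 : ℕ) : ℝ≥0∞)⁻¹ = 1 :=
    ENNReal.mul_inv_cancel (by rw [Nat.cast_ne_zero]; omega) (ENNReal.natCast_ne_top _)
  generalize ((2 * k : ℕ) : ℝ≥0∞) = K at *
  generalize ((2 * k - 1 : ℕ) : ℝ≥0∞) = q at *
  calc K * q⁻¹ * q ^ (2 * P.length) * (K⁻¹ * q⁻¹ ^ (P.length + A.length) *
        (K⁻¹ * q⁻¹ ^ (P.length + B.length)))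
      = (K * K⁻¹) * (q * q⁻¹) ^ (2 * P.length) * (K⁻¹ * q⁻¹ ^ (A.length + B.length + 1)) := by ring
    _ = _ := by rw [c1, c2]; simp

theorem not_isPre_of_ne {u v : FreeGroup (Fin k)} (hne : u ≠ v) (h : u.norm = v.norm) :
    ¬ IsPre u v := fun H => hne (H.eq_of_norm h.ge)

theorem value_ne_top (hk : 2 ≤ k) (n : ℕ) :
    ((2 * k : ℕ) : ℝ≥0∞)⁻¹ * ((2 * k - 1 : ℕ) : ℝ≥0∞)⁻¹ ^ n ≠ ∞ := by
  refine ENNReal.mul_ne_top (ENNReal.inv_ne_top.2 (by simp; omega))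
    (ENNReal.pow_ne_top (ENNReal.inv_ne_top.2 (by rw [Nat.cast_ne_zero]; omega)))

theorem nA_rects_ne_top (hk : 2 ≤ k) (N : ℕ) : ∀ R ∈ rects k N, nA k R ≠ ∞ := by
  rintro _ ⟨u, v, hne, e, -, rfl⟩
  rw [nA_rect hk (not_isPre_of_ne hne e) (not_isPre_of_ne hne.symm e.symm)]
  exact value_ne_top hk _

theorem nA_locallyFinite (hk : 2 ≤ k) : IsLocallyFiniteMeasure (nA k) := by
  refine ⟨fun q => ?_⟩
  obtain ⟨R, hR, hq, -⟩ :=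
    (isTopologicalBasis_rects k 0).exists_subset_of_mem_open (Set.mem_univ q) isOpen_univ
  exact ⟨R, (isTopologicalBasis_rects k 0).mem_nhds hR hq, (nA_rects_ne_top hk 0 R hR).lt_top⟩

theorem nA_invariant (hk : 2 ≤ k) (g : FreeGroup (Fin k)) :
    (nA k).map (fun q => g • q) = nA k := by
  symm
  apply ext_of_rects (2 * g.norm) (nA_rects_ne_top hk _)
  rintro _ ⟨u, v, hne, e, hN, rfl⟩
  have hm : Measurable fun q : Boundary2 k => g • q := (continuous_const_smul g).measurable
  rw [Measure.map_apply hm (isOpen_rect u v).measurableSet]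
  have hpre : (fun q : Boundary2 k => g • q) ⁻¹' rect u v = rect (g⁻¹ * u) (g⁻¹ * v) := by
    ext q
    exact and_congr (smul_shadow g hN q.1.1) (smul_shadow g (by omega) q.1.2)
  have hn : ∀ w : FreeGroup (Fin k), 2 * g.norm < w.norm → g.norm < (g⁻¹ * w).norm := by
    intro w hw
    have := norm_le_mul g⁻¹ w
    rw [FreeGroup.norm_inv_eq] at this
    omega
  have hnp : ∀ w z : FreeGroup (Fin k), 2 * g.norm < w.norm → ¬ IsPre w z →
      ¬ IsPre (g⁻¹ * w) (g⁻¹ * z) := by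
    intro w z hw h H
    have := H.mul_left g (hn w hw)
    rw [mul_inv_cancel_left, mul_inv_cancel_left] at this
    exact h this
  have h1 := not_isPre_of_ne hne e
  have h2 := not_isPre_of_ne hne.symm e.symm
  rw [hpre, nA_rect hk h1 h2, nA_rect hk (hnp u v hN h1) (hnp v u (by omega) h2)]
  congr 4
  group

theorem nA_cyl (hk : 2 ≤ k) {x y : FreeGroup (Fin k)} (hxy : x ≠ y) :
    nA k (Cyl x y) =
      ((2 * k : ℕ) : ℝ≥0∞)⁻¹ * ((2 * k - 1 : ℕ) : ℝ≥0∞)⁻¹ ^ ((x⁻¹ * y).norm - 1) := by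
  have hv : x⁻¹ * y ≠ 1 := fun h => hxy (by rw [inv_mul_eq_one] at h; exact h)
  generalize hvd : x⁻¹ * y = v at *
  obtain ⟨s, L, hL⟩ := List.exists_cons_of_ne_nil (l := v.toWord) (by simpa using hv)
  have hw : ∀ b : Letter k, (letter b).toWord = [b] := fun b => by simp [letter]
  have hset : Cyl x y = (fun q : Boundary2 k => x⁻¹ • q) ⁻¹'
      ⋃ b ∈ Finset.univ.erase s, rect (letter b) v := by
    ext q
    rw [mem_cyl_iff, hvd]
    have hsh : ∀ (b : Letter k) (ω : Boundary k), ω ∈ shadow (letter b) ↔ ω.1 0 = b := by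
      intro b ω
      rw [shadow, Set.mem_ofPred_eq, norm_letter, ← FreeGroup.toWord_inj, toWord_pre, hw]
      simp
    have h0 : ∀ ω ∈ shadow v, ω.1 0 = s := by
      intro ω hω
      have h1 := getElem?_pre (ω := ω) (n := v.norm) (i := 0) (by simp [FreeGroup.norm, hL])
      rw [show pre ω v.norm = v from hω, hL] at h1
      simpa using h1.symm
    simp only [Set.mem_preimage, Set.mem_iUnion, Finset.mem_erase, Finset.mem_univ, and_true]
    constructor
    · rintro ⟨h1, h2⟩
      refine ⟨_, ?_, (hsh _ _).2 rfl, h2⟩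
      change (x⁻¹ • q.1.1).1 0 ≠ s
      rwa [← h0 _ h2]
    · rintro ⟨b, hb, h1, h2⟩
      refine ⟨fun e => hb ?_, h2⟩
      exact ((hsh _ _).1 h1).symm.trans (e.trans (h0 _ h2))
  have hmeas : ∀ b : Letter k, MeasurableSet (rect (letter b) v) :=
    fun b => (isOpen_rect _ _).measurableSet
  have hm : Measurable fun q : Boundary2 k => x⁻¹ • q := (continuous_const_smul x⁻¹).measurable
  rw [hset, ← Measure.map_apply hm (Finset.measurableSet_biUnion _ fun b _ => hmeas b),
    nA_invariant hk, measure_biUnion_finset _ fun b _ => hmeas b]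
  · have hval : ∀ b ∈ Finset.univ.erase s, nA k (rect (letter b) v) =
        ((2 * k : ℕ) : ℝ≥0∞)⁻¹ * ((2 * k - 1 : ℕ) : ℝ≥0∞)⁻¹ ^ v.norm := by
      intro b hb
      have hb' : b ≠ s := (Finset.mem_erase.1 hb).1
      have h1 : ¬ IsPre (letter b) v := by
        rw [IsPre, hw, hL]; simpa using hb'
      have h2 : ¬ IsPre v (letter b) := by
        rw [IsPre, hw, hL]
        intro H
        have := List.cons_prefix_cons.1 H
        exact hb' this.1.symm
      rw [nA_rect hk h1 h2, norm_inv_mul_of_ne (P := []) (hw b) hL hb']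
      congr 2
      simp [FreeGroup.norm, hL]
    rw [Finset.sum_congr rfl hval, Finset.sum_const, Finset.card_erase_of_mem (Finset.mem_univ s)]
    have hcard : (Finset.univ : Finset (Letter k)).card = 2 * k := by simp [mul_comm]
    have hvn : v.norm = v.norm - 1 + 1 := by
      have : v.norm = L.length + 1 := by simp [FreeGroup.norm, hL]
      omega
    have c2 : ((2 * k - 1 : ℕ) : ℝ≥0∞) * ((2 * k - 1 : ℕ) : ℝ≥0∞)⁻¹ = 1 :=
      ENNReal.mul_inv_cancel (by rw [Nat.cast_ne_zero]; omega) (ENNReal.natCast_ne_top _)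
    rw [hcard, nsmul_eq_mul, hvn, pow_succ, Nat.add_sub_cancel]
    generalize ((2 * k - 1 : ℕ) : ℝ≥0∞) = q at *
    generalize ((2 * k : ℕ) : ℝ≥0∞) = K at *
    calc q * (K⁻¹ * (q⁻¹ ^ (v.norm - 1) * q⁻¹)) = q * q⁻¹ * (K⁻¹ * q⁻¹ ^ (v.norm - 1)) := by ring
      _ = _ := by rw [c2, one_mul]
  · intro b _ b' _ hbb
    refine Set.disjoint_left.2 fun q h1 h2 => hbb ?_
    have e1 : pre q.1.1 1 = letter b := by
      have := h1.1
      rwa [shadow, Set.mem_ofPred_eq, norm_letter] at this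
    have e2 : pre q.1.1 1 = letter b' := by
      have := h2.1
      rwa [shadow, Set.mem_ofPred_eq, norm_letter] at this
    have := congrArg FreeGroup.toWord (e1.symm.trans e2)
    rw [hw, hw] at this
    simpa using this

end uniform

/-- The uniform current `n_A` corresponding to the free basis `A`. By `uniformCurrent_cyl` below,
it is the geodesic current with `n_A(Cyl_X(γ)) = 1 / (2k (2k-1)^{|γ|-1})` for every segment `γ` of
positive length. -/
noncomputable def uniformCurrent (k : ℕ) (hk : 2 ≤ k) : GeodesicCurrent k where
  toMeasure := nA k
  regular := by
    have := nA_locallyFinite hk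
    infer_instance
  invariant := nA_invariant hk

/-- The values of the uniform current on cylinders. -/
theorem uniformCurrent_cyl {k : ℕ} (hk : 2 ≤ k) {x y : FreeGroup (Fin k)} (hxy : x ≠ y) :
    (uniformCurrent k hk).toMeasure.real (Cyl x y) =
      1 / (2 * k * (2 * k - 1) ^ ((x⁻¹ * y).norm - 1)) := by
  change (nA k).real (Cyl x y) = _
  rw [Measure.real, nA_cyl hk hxy, ENNReal.toReal_mul, ENNReal.toReal_pow, ENNReal.toReal_inv,
    ENNReal.toReal_inv, ENNReal.toReal_natCast, ENNReal.toReal_natCast]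
  have : 1 ≤ 2 * k := by omega
  push_cast [this]
  rw [one_div, mul_inv (2 * (k : ℝ)), inv_pow]

end FreeCurrents

/-!
A clopen set `U` of the boundary has a cost, the `n_A`-measure of the geodesics that enter `U`, and
`L(φ n_A)` is the sum over the letters `s` of the cost of the preimage under `∂φ` of the set of
rays starting with `s` (`length_smul_uniformCurrent`). The cost is invariant under translations and
complements and strictly submodular on crossing sets (`cost_inter_add_cost_union_lt`), because
`n_A` has full support.

Among nontrivial clopen sets, exactly the half-trees of the Cayley graph have the minimal cost
`1 / (2k)` (`cost_one_lower`). Indeed, a clopen set that is not a union of directions at a single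
vertex has an outermost vertex, at which it is constant in all directions but one
(`exists_vertex`), and uncrossing it with that direction gives a cheaper set; unions of directions
at a vertex are measured directly. In particular `L(φ n_A) ≥ 1`. If every direction has minimal
cost for `φ`, then `∂φ` carries the directions at some vertex to the directions at `1`, and `φ` is
simple (`isSimple_of_cost_eq`).

Suppose that `φ` is not simple, so that some direction `b` is not of minimal cost for `φ`. Some
half-tree has an image `H` under `∂φ` that separates the two ends of the axis of `b`; it has minimal
cost for `φ`. If `H` is, up to translation, a set `S` of directions at `1`, then `S` separates `b`
from `b⁻¹` and is cheaper than `b`. Otherwise, at an outermost vertex for `H`, uncrossing `H` or its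
complement with the remaining direction `f` produces a set of directions that contains `f⁻¹` but not
`f` and is cheaper than `f` (`exists_cost_sectors_lt`). In both cases, replacing a letter by a
cheaper set of directions is the effect of a Whitehead automorphism on the cost
(`exists_whitehead_length_lt`), which is therefore the required `τ`.
-/

namespace FreeCurrents

/-! ### First letters of words and of rays -/

/-- The inverse of a letter, as a letter. -/
def linv {k : ℕ} (s : Letter k) : Letter k := (s.1, !s.2)

section letters

variable {k : ℕ}

@[simp] theorem linv_linv (s : Letter k) : linv (linv s) = s := by simp [linv]

theorem linv_ne (s : Letter k) : linv s ≠ s := fun h => by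
  have := congrArg Prod.snd h
  simp [linv] at this

theorem linv_injective : Function.Injective (linv (k := k)) :=
  Function.LeftInverse.injective linv_linv

theorem letter_linv (s : Letter k) : letter (linv s) = (letter s)⁻¹ := by
  simp [letter, linv, FreeGroup.inv_mk, FreeGroup.invRev]

theorem toWord_letter (s : Letter k) : (letter s).toWord = [s] := by simp [letter]

theorem letter_injective : Function.Injective (letter (k := k)) := fun s t h => by
  simpa [toWord_letter] using congrArg FreeGroup.toWord h

theorem letter_ne_one (s : Letter k) : letter s ≠ 1 := fun h => by
  simpa [toWord_letter] using congrArg FreeGroup.toWord h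

theorem toWord_letter_mul (s : Letter k) (g : FreeGroup (Fin k)) :
    (g.toWord[0]? ≠ some (linv s) ∧ (letter s * g).toWord = s :: g.toWord) ∨
      g.toWord = linv s :: (letter s * g).toWord := by
  have hr : FreeGroup.reduce g.toWord = g.toWord := by simp
  have e : (letter s * g).toWord = FreeGroup.reduce (s :: g.toWord) := by
    rw [FreeGroup.toWord_mul, toWord_letter]; rfl
  rw [e, FreeGroup.reduce.cons, hr]
  rcases hg : g.toWord with _ | ⟨t, T⟩
  · left; simp
  · by_cases h : s.1 = t.1 ∧ s.2 = !t.2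
    · right
      have ht : t = linv s := Prod.ext h.1.symm (by simp [linv, h.2])
      dsimp only
      rw [if_pos h, ht]
    · left
      simp only [h, if_false, and_true]
      rintro h'
      have ht : t = linv s := by simpa using h'
      exact h ⟨by simp [ht, linv], by simp [ht, linv]⟩

theorem head_letter_mul (s : Letter k) (g : FreeGroup (Fin k)) :
    (letter s * g).toWord[0]? = some s ↔ g.toWord[0]? ≠ some (linv s) := by
  rcases toWord_letter_mul s g with ⟨h1, h2⟩ | h
  · simp [h1, h2]
  · have hr := FreeGroup.isReduced_toWord (x := g)
    simp only [h, List.getElem?_cons_zero, ne_eq, not_true, iff_false]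
    intro h'
    rcases hw : (letter s * g).toWord with _ | ⟨t, T⟩
    · simp [hw] at h'
    · have ht : t = s := by simpa [hw] using h'
      rw [h, hw, ht, FreeGroup.isReduced_cons_cons] at hr
      simp [linv] at hr

theorem head_ne_none {g : FreeGroup (Fin k)} (hg : g ≠ 1) : ∃ s, g.toWord[0]? = some s := by
  obtain ⟨x, L, h⟩ := List.exists_cons_of_ne_nil (l := g.toWord) (by simpa using hg)
  exact ⟨x, by simp [h]⟩

theorem toWord_mul_letter_of_norm {x : FreeGroup (Fin k)} {t : Letter k}
    (h : (x * letter t).norm = x.norm + 1) : (x * letter t).toWord = x.toWord ++ [t] := by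
  rcases toWord_mul_letter x t with H | H
  · exact H
  · have := congrArg List.length H
    simp only [FreeGroup.norm] at h
    simp at this; omega

theorem head_inv_mul_iff {x : FreeGroup (Fin k)} {t : Letter k}
    (hx : (x * letter t).norm = x.norm + 1) (h : FreeGroup (Fin k)) :
    (x⁻¹ * h).toWord[0]? = some t ↔ IsPre (x * letter t) h := by
  have hw := toWord_mul_letter_of_norm hx
  constructor
  · intro H
    rcases hT : (x⁻¹ * h).toWord with _ | ⟨t', T⟩
    · simp [hT] at H
    · obtain rfl : t' = t := by simpa [hT] using H
      have e : h = FreeGroup.mk (x.toWord ++ t' :: T) := by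
        rw [← FreeGroup.mul_mk, FreeGroup.mk_toWord, ← hT, FreeGroup.mk_toWord, mul_inv_cancel_left]
      have hr1 := FreeGroup.isReduced_toWord (x := x * letter t')
      have hr2 := FreeGroup.isReduced_toWord (x := x⁻¹ * h)
      rw [hw] at hr1
      rw [hT] at hr2
      have hr : FreeGroup.IsReduced (x.toWord ++ [t'] ++ T) :=
        FreeGroup.IsReduced.append_overlap hr1 hr2 (by simp)
      refine ⟨T, ?_⟩
      rw [hw, e, FreeGroup.toWord_mk]
      rw [List.append_assoc] at hr ⊢
      exact hr.reduce_eq.symm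
  · rintro ⟨L, hL⟩
    rw [hw, List.append_assoc] at hL
    have e : x⁻¹ * h = FreeGroup.mk (t :: L) := by
      rw [inv_mul_eq_iff_eq_mul]
      conv_rhs => rw [← FreeGroup.mk_toWord (x := x), FreeGroup.mul_mk]
      rw [← FreeGroup.mk_toWord (x := h), ← hL]; rfl
    have hred : FreeGroup.IsReduced (t :: L) := by
      refine (FreeGroup.isReduced_toWord (x := h)).infix ?_
      rw [← hL]; exact (List.suffix_append _ _).isInfix
    rw [e, FreeGroup.toWord_mk, hred.reduce_eq]; rfl

/-- The first letter of a limit is the eventual first letter. -/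
theorem ConvergesTo.head_eq {u : ℕ → FreeGroup (Fin k)} {ω : Boundary k} (h : ConvergesTo u ω)
    {s : Letter k} (hs : ∃ᶠ n in atTop, (u n).toWord[0]? = some s) : ω.1 0 = s := by
  obtain ⟨n, h1, h2⟩ := (hs.and_eventually (h 0)).exists
  exact Option.some_injective _ (h2.symm.trans h1)

theorem head_pre (ω : Boundary k) {n : ℕ} (hn : 0 < n) : (pre ω n).toWord[0]? = some (ω.1 0) :=
  getElem?_pre hn

theorem letter_smul_head (l : Letter k) (ξ : Boundary k) :
    (letter l • ξ).1 0 = l ↔ ξ.1 0 ≠ linv l := by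
  obtain ⟨n, h1, h2⟩ :=
    (((convergesTo_pre ξ).smul (letter l) 0).and (eventually_gt_atTop 0)).exists
  have h3 := head_letter_mul l (pre ξ n)
  rw [h1, head_pre ξ h2] at h3
  simpa using h3

theorem inv_smul_head {x : FreeGroup (Fin k)} {t : Letter k}
    (hx : (x * letter t).norm = x.norm + 1) (ω : Boundary k) :
    (x⁻¹ • ω).1 0 = t ↔ ω ∈ shadow (x * letter t) := by
  obtain ⟨n, h1, h2⟩ := (((convergesTo_pre ω).smul x⁻¹ 0).and
    (eventually_ge_atTop (x * letter t).norm)).exists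
  rw [mem_shadow_iff h2, ← head_inv_mul_iff hx, h1]
  simp

theorem exists_last {x : FreeGroup (Fin k)} (hx : x ≠ 1) :
    ∃ y l, x = y * letter l ∧ (y * letter l).norm = y.norm + 1 := by
  rcases List.eq_nil_or_concat x.toWord with h | ⟨L, t, h⟩
  · exact absurd (by simpa using h) hx
  · rw [List.concat_eq_append] at h
    have hred : FreeGroup.IsReduced L := by
      refine (FreeGroup.isReduced_toWord (x := x)).infix ?_
      rw [h]; exact (List.prefix_append _ _).isInfix
    have e : x = FreeGroup.mk L * letter t := by
      rw [letter, FreeGroup.mul_mk, ← h, FreeGroup.mk_toWord]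
    refine ⟨FreeGroup.mk L, t, e, ?_⟩
    rw [← e, FreeGroup.norm, h, FreeGroup.norm, FreeGroup.toWord_mk, hred.reduce_eq]
    simp

/-- Seen from the end `y l` of a nontrivial reduced word, the shadow of that word is the complement
of the direction that leads back to `1`. -/
theorem mem_shadow_iff_head {y : FreeGroup (Fin k)} {l : Letter k}
    (h : (y * letter l).norm = y.norm + 1) (ω : Boundary k) :
    ω ∈ shadow (y * letter l) ↔ ((y * letter l)⁻¹ • ω).1 0 ≠ linv l := by
  rw [← inv_smul_head h, ← letter_smul_head, smul_smul]
  simp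

theorem norm_mul_letter (x : FreeGroup (Fin k)) (t : Letter k) :
    (x * letter t).norm = x.norm + 1 ∨
      ∃ y, x = y * letter (linv t) ∧ (y * letter (linv t)).norm = y.norm + 1 := by
  rcases toWord_mul_letter x t with H | H
  · left; simp [FreeGroup.norm, H]
  · right
    refine ⟨x * letter t, ?_, ?_⟩
    · rw [letter_linv]; simp
    · have e : x * letter t * letter (linv t) = x := by rw [letter_linv]; simp
      rw [e, FreeGroup.norm, H, FreeGroup.norm]; simp

/-- Every translate of the set of rays starting with a given letter is a shadow or the complement
of a shadow. -/
theorem smul_head_eq_cases (x : FreeGroup (Fin k)) (t : Letter k) :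
    ∃ w : FreeGroup (Fin k), w ≠ 1 ∧ w.norm ≤ x.norm + 1 ∧ ({ω : Boundary k | (x⁻¹ • ω).1 0 = t} = shadow w ∨
      {ω : Boundary k | (x⁻¹ • ω).1 0 = t} = (shadow w)ᶜ ∧ w = x) := by
  rcases norm_mul_letter x t with h | ⟨y, rfl, h⟩
  · refine ⟨x * letter t, fun e => ?_, h.le, Or.inl (Set.ext fun ω => inv_smul_head h ω)⟩
    rw [e] at h; simp at h
  · refine ⟨_, fun e => ?_, Nat.le_succ _, Or.inr ⟨Set.ext fun ω => ?_, rfl⟩⟩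
    · rw [e] at h; simp at h
    · rw [Set.mem_compl_iff, mem_shadow_iff_head h]
      simp

end letters

/-! ### The cost of a clopen set -/

section cost

variable {k : ℕ}

/-- The pairs of boundary points whose geodesic enters `U`. -/
def cut (U : Set (Boundary k)) : Set (Boundary2 k) := {q | q.1.1 ∉ U ∧ q.1.2 ∈ U}

/-- The `φ n_A`-measure of the geodesics that enter `U`. -/
noncomputable def cost (φ : MulAut (FreeGroup (Fin k))) (U : Set (Boundary k)) : ℝ :=
  (nA k).real (cut (bdHomeo φ ⁻¹' U))

theorem isClopen_cut {U : Set (Boundary k)} (hU : IsClopen U) : IsClopen (cut U) :=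
  (hU.compl.preimage (continuous_fst.comp continuous_subtype_val)).inter
    (hU.preimage (continuous_snd.comp continuous_subtype_val))

theorem isCompact_cut {U : Set (Boundary k)} (hU : IsClopen U) : IsCompact (cut U) := by
  rw [Subtype.isCompact_iff]
  convert (hU.compl.isClosed.prod hU.isClosed).isCompact using 1
  ext p
  constructor
  · rintro ⟨q, hq, rfl⟩
    exact hq
  · intro hp
    exact ⟨⟨p, fun e => hp.1 (by rw [e]; exact hp.2)⟩, hp, rfl⟩

theorem nA_cut_ne_top (hk : 2 ≤ k) {U : Set (Boundary k)} (hU : IsClopen U) :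
    nA k (cut U) ≠ ∞ := by
  have := nA_locallyFinite hk
  exact (isCompact_cut hU).measure_lt_top.ne

theorem nA_pos_of_isOpen (hk : 2 ≤ k) {O : Set (Boundary2 k)} (hO : IsOpen O) (hne : O.Nonempty) :
    0 < nA k O := by
  obtain ⟨q, hq⟩ := hne
  obtain ⟨R, ⟨u, v, hne, e, -, rfl⟩, -, hRO⟩ :=
    (isTopologicalBasis_rects k 0).exists_subset_of_mem_open hq hO
  refine lt_of_lt_of_le ?_ (measure_mono hRO)
  rw [nA_rect hk (not_isPre_of_ne hne e) (not_isPre_of_ne hne.symm e.symm)]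
  refine ENNReal.mul_pos (ENNReal.inv_ne_zero.2 (ENNReal.natCast_ne_top _)) (pow_ne_zero _ ?_)
  exact ENNReal.inv_ne_zero.2 (ENNReal.natCast_ne_top _)

/-- The coordinate flip of `∂²F`. -/
def flip (q : Boundary2 k) : Boundary2 k := ⟨(q.1.2, q.1.1), q.2.symm⟩

theorem continuous_flip : Continuous (flip (k := k)) :=
  Continuous.subtype_mk ((continuous_snd.comp continuous_subtype_val).prodMk
    (continuous_fst.comp continuous_subtype_val)) _

theorem nA_map_flip (hk : 2 ≤ k) : (nA k).map flip = nA k := by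
  symm
  apply ext_of_rects 0 (nA_rects_ne_top hk _)
  rintro _ ⟨u, v, hne, e, -, rfl⟩
  have hpre : flip ⁻¹' rect u v = rect v u := by
    ext q
    exact and_comm
  have h1 := not_isPre_of_ne hne e
  have h2 := not_isPre_of_ne hne.symm e.symm
  rw [Measure.map_apply continuous_flip.measurable (isOpen_rect u v).measurableSet, hpre,
    nA_rect hk h1 h2, nA_rect hk h2 h1, ← FreeGroup.norm_inv_eq (x := u⁻¹ * v), mul_inv_rev, inv_inv]

theorem isClopen_preimage_bdHomeo (φ : MulAut (FreeGroup (Fin k))) {U : Set (Boundary k)}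
    (hU : IsClopen U) : IsClopen (bdHomeo φ ⁻¹' U) :=
  hU.preimage (bdHomeo φ).continuous

theorem isClopen_smul_preimage (g : FreeGroup (Fin k)) {U : Set (Boundary k)}
    (hU : IsClopen U) : IsClopen {ω | g • ω ∈ U} :=
  hU.preimage (continuous_const_smul g)

theorem cost_compl (hk : 2 ≤ k) (φ : MulAut (FreeGroup (Fin k))) {U : Set (Boundary k)}
    (hU : IsClopen U) : cost φ Uᶜ = cost φ U := by
  have h := (isClopen_cut (isClopen_preimage_bdHomeo φ hU)).isOpen.measurableSet
  rw [cost, cost, ← nA_map_flip hk, map_measureReal_apply continuous_flip.measurable h,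
    nA_map_flip hk]
  congr 1
  ext q
  simp [cut, flip, and_comm]

theorem cost_smul (hk : 2 ≤ k) (φ : MulAut (FreeGroup (Fin k))) (g : FreeGroup (Fin k))
    {U : Set (Boundary k)} (hU : IsClopen U) : cost φ {ω | g • ω ∈ U} = cost φ U := by
  have hm : Measurable fun q : Boundary2 k => φ⁻¹ g • q :=
    (continuous_const_smul (φ⁻¹ g)).measurable
  have h := (isClopen_cut (isClopen_preimage_bdHomeo φ hU)).isOpen.measurableSet
  have e : cut (bdHomeo φ ⁻¹' {ω | g • ω ∈ U}) =
      (fun q : Boundary2 k => φ⁻¹ g • q) ⁻¹' cut (bdHomeo φ ⁻¹' U) := by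
    have key : ∀ ω : Boundary k, bdHomeo φ (φ⁻¹ g • ω) = g • bdHomeo φ ω := fun ω => by
      rw [bdHomeo_smul, MulAut.apply_inv_self]
    ext q
    have h1 := key q.1.1
    have h2 := key q.1.2
    change (¬ g • bdHomeo φ q.1.1 ∈ U ∧ g • bdHomeo φ q.1.2 ∈ U) ↔
      (¬ bdHomeo φ (φ⁻¹ g • q.1.1) ∈ U ∧ bdHomeo φ (φ⁻¹ g • q.1.2) ∈ U)
    rw [h1, h2]
  rw [cost, cost, e, ← map_measureReal_apply hm h, nA_invariant hk]

theorem cost_mul (φ ψ : MulAut (FreeGroup (Fin k))) (U : Set (Boundary k)) :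
    cost (φ * ψ) U = cost ψ (bdHomeo φ ⁻¹' U) := by
  rw [cost, cost]
  congr 2
  ext ω
  simp only [Set.mem_preimage, bdHomeo_mul]

theorem cost_eq_cost_one (φ : MulAut (FreeGroup (Fin k))) (U : Set (Boundary k)) :
    cost φ U = cost 1 (bdHomeo φ ⁻¹' U) := by
  rw [← cost_mul, mul_one]

/-- Strict submodularity: uncrossing two crossing sets strictly lowers the total cost, because the
geodesics from `P \ Q` to `Q \ P` are no longer counted. -/
theorem cost_inter_add_cost_union_lt (hk : 2 ≤ k) (φ : MulAut (FreeGroup (Fin k)))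
    {P Q : Set (Boundary k)} (hP : IsClopen P) (hQ : IsClopen Q)
    (h1 : (P \ Q).Nonempty) (h2 : (Q \ P).Nonempty) :
    cost φ (P ∩ Q) + cost φ (P ∪ Q) < cost φ P + cost φ Q := by
  simp only [cost, Set.preimage_inter, Set.preimage_union]
  have h1' := h1.preimage (bdHomeo φ).surjective
  have h2' := h2.preimage (bdHomeo φ).surjective
  rw [Set.preimage_sdiff] at h1' h2'
  have hP' := isClopen_preimage_bdHomeo φ hP
  have hQ' := isClopen_preimage_bdHomeo φ hQ
  generalize bdHomeo φ ⁻¹' P = P at *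
  generalize bdHomeo φ ⁻¹' Q = Q at *
  have meas : ∀ {U : Set (Boundary k)}, IsClopen U → MeasurableSet (cut U) := fun hU =>
    (isClopen_cut hU).isOpen.measurableSet
  have fin : ∀ {U : Set (Boundary k)}, IsClopen U → nA k (cut U) ≠ ∞ := nA_cut_ne_top hk
  rw [← measureReal_union_add_inter (meas (hP'.union hQ')) (fin (hP'.inter hQ'))
      (fin (hP'.union hQ')),
    ← measureReal_union_add_inter (meas hQ') (fin hP') (fin hQ')]
  set E : Set (Boundary2 k) := {q | q.1.1 ∈ P \ Q ∧ q.1.2 ∈ Q \ P} with hE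
  have hEo : IsOpen E :=
    ((hP'.diff hQ').isOpen.preimage (continuous_fst.comp continuous_subtype_val)).inter
      ((hQ'.diff hP').isOpen.preimage (continuous_snd.comp continuous_subtype_val))
  have hEne : E.Nonempty := by
    obtain ⟨ζ, hζ⟩ := h1'
    obtain ⟨ξ, hξ⟩ := h2'
    exact ⟨⟨(ζ, ξ), fun e => hζ.2 (by simp only at e; rw [e]; exact hξ.1)⟩, hζ, hξ⟩
  have hint : cut (P ∩ Q) ∩ cut (P ∪ Q) = cut P ∩ cut Q := by
    ext q
    simp only [cut, Set.mem_inter_iff, Set.mem_union, Set.mem_ofPred_eq]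
    tauto
  have hsub : E ∪ (cut (P ∩ Q) ∪ cut (P ∪ Q)) ⊆ cut P ∪ cut Q := by
    rintro q
    simp only [hE, cut, Set.mem_inter_iff, Set.mem_union, Set.mem_ofPred_eq, Set.mem_sdiff]
    tauto
  have hdisj : Disjoint E (cut (P ∩ Q) ∪ cut (P ∪ Q)) := by
    rw [Set.disjoint_left]
    rintro q
    simp only [hE, cut, Set.mem_inter_iff, Set.mem_union, Set.mem_ofPred_eq, Set.mem_sdiff]
    tauto
  have hfin : nA k (cut P ∪ cut Q) ≠ ∞ :=
    (measure_union_lt_top (fin hP').lt_top (fin hQ').lt_top).ne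
  have hle := measureReal_mono hsub hfin
  have hfE : nA k E ≠ ∞ := ne_top_of_le_ne_top hfin
    (measure_mono (Set.subset_union_left.trans hsub))
  rw [measureReal_union hdisj ((meas (hP'.inter hQ')).union (meas (hP'.union hQ'))) hfE
    (ne_top_of_le_ne_top hfin (measure_mono (Set.subset_union_right.trans hsub)))] at hle
  have hpos : 0 < (nA k).real E := ENNReal.toReal_pos (nA_pos_of_isOpen hk hEo hEne).ne' hfE
  rw [hint]
  linarith

/-- The rays whose first letter lies in `S`. -/
def sectors (S : Set (Letter k)) : Set (Boundary k) := {ω | ω.1 0 ∈ S}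

theorem isClopen_sectors (S : Set (Letter k)) : IsClopen (sectors S) :=
  (isClopen_discrete S).preimage ((continuous_apply 0).comp continuous_subtype_val)

theorem shadow_letter (s : Letter k) : shadow (letter s) = sectors {s} := by
  ext ω
  have h1 := inv_smul_head (x := 1) (t := s) (by rw [one_mul, norm_letter]; simp) ω
  rw [one_mul, inv_one, one_smul] at h1
  exact h1.symm

theorem rect_letter (s t : Letter k) :
    rect (letter s) (letter t) = {q : Boundary2 k | q.1.1.1 0 = s ∧ q.1.2.1 0 = t} := by
  simp only [rect, shadow_letter]; rfl

theorem nA_rect_letter (hk : 2 ≤ k) {s t : Letter k} (h : s ≠ t) :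
    (nA k).real (rect (letter s) (letter t)) = 1 / (2 * k * (2 * k - 1)) := by
  have e : ∀ {s t : Letter k}, s ≠ t → ¬ IsPre (letter s) (letter t) := fun h =>
    not_isPre_of_ne (letter_injective.ne h) (by rw [norm_letter, norm_letter])
  rw [measureReal_def, nA_rect hk (e h) (e h.symm),
    norm_inv_mul_of_ne (P := []) (toWord_letter s) (toWord_letter t) h, ENNReal.toReal_mul,
    ENNReal.toReal_pow, ENNReal.toReal_inv, ENNReal.toReal_inv, ENNReal.toReal_natCast,
    ENNReal.toReal_natCast]
  have : 1 ≤ 2 * k := by omega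
  push_cast [this]
  rw [one_div, mul_inv (2 * (k : ℝ))]
  simp

theorem card_letter : Fintype.card (Letter k) = 2 * k := by simp [mul_comm]

open Classical in
theorem cost_one_sectors (hk : 2 ≤ k) (S : Finset (Letter k)) :
    cost 1 (sectors (S : Set (Letter k))) =
      ((2 * k - S.card : ℝ) * S.card) / (2 * k * (2 * k - 1)) := by
  have e : cut (bdHomeo 1 ⁻¹' sectors (S : Set (Letter k))) =
      ⋃ p ∈ Sᶜ ×ˢ S, rect (letter p.1) (letter p.2) := by
    ext q
    simp only [cut, sectors, Set.mem_preimage, bdHomeo_one, rect_letter, Set.mem_iUnion,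
      Set.mem_ofPred_eq, Finset.mem_product, Finset.mem_compl, Finset.mem_coe]
    constructor
    · rintro h
      exact ⟨(_, _), h, rfl, rfl⟩
    · rintro ⟨⟨s, t⟩, h, rfl, rfl⟩
      exact h
  have hne : ∀ p ∈ Sᶜ ×ˢ S, p.1 ≠ p.2 := by
    rintro ⟨s, t⟩ h (rfl : s = t)
    simp at h
  have hfin : ∀ p ∈ Sᶜ ×ˢ S, nA k (rect (letter p.1) (letter p.2)) ≠ ∞ := by
    intro p hp
    have h1 := nA_rect_letter hk (hne p hp)
    intro h
    rw [measureReal_def, h, ENNReal.toReal_top] at h1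
    have : (2 : ℝ) ≤ k := by exact_mod_cast hk
    have : (0 : ℝ) < 1 / (2 * k * (2 * k - 1)) := by
      apply one_div_pos.2; apply mul_pos <;> linarith
    linarith
  rw [cost, e, measureReal_biUnion_finset _ (fun p _ => (isOpen_rect _ _).measurableSet) hfin,
    Finset.sum_congr rfl fun p hp => nA_rect_letter hk (hne p hp), Finset.sum_const,
    Finset.card_product, Finset.card_compl, card_letter, nsmul_eq_mul, Nat.cast_mul,
    Nat.cast_sub (by rw [← card_letter]; exact Finset.card_le_univ S)]
  · push_cast; ring
  · rintro ⟨s, t⟩ - ⟨s', t'⟩ - hne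
    rw [Function.onFun, rect_letter, rect_letter, Set.disjoint_left]
    rintro q ⟨h1, h2⟩ ⟨h3, h4⟩
    exact hne (Prod.ext (h1.symm.trans h3) (h2.symm.trans h4))

theorem cost_one_sectors_lower (hk : 2 ≤ k) {S : Set (Letter k)} (hS : S.Nonempty)
    (hS' : Sᶜ.Nonempty) : 1 / (2 * k : ℝ) ≤ cost 1 (sectors S) ∧
      (cost 1 (sectors S) = 1 / (2 * k : ℝ) → ∃ s, S = {s} ∨ S = {s}ᶜ) := by
  classical
  obtain ⟨T, rfl⟩ := S.toFinite.exists_finset_coe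
  have h1 : 1 ≤ T.card := Finset.card_pos.2 (by simpa using hS)
  have h2 : T.card + 1 ≤ 2 * k := by
    rw [← card_letter (k := k), Nat.succ_le_iff, Finset.card_lt_iff_ne_univ]
    rintro rfl
    simp at hS'
  rw [cost_one_sectors hk]
  have hk' : (2 : ℝ) ≤ k := by exact_mod_cast hk
  have hpos : (0 : ℝ) < 2 * k * (2 * k - 1) := by apply mul_pos <;> linarith
  have e : 1 / (2 * k : ℝ) = (2 * k - 1) / (2 * k * (2 * k - 1)) := by
    have : (2 * k - 1 : ℝ) ≠ 0 := by linarith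
    have : (k : ℝ) ≠ 0 := by linarith
    field_simp
  have h1' : (1 : ℝ) ≤ T.card := by exact_mod_cast h1
  have h2' : (T.card : ℝ) + 1 ≤ 2 * k := by exact_mod_cast h2
  rw [e, div_le_div_iff_of_pos_right hpos, div_left_inj' hpos.ne']
  refine ⟨by nlinarith, fun h => ?_⟩
  -- the two sides differ by the product of `|T| - 1` and `|Tᶜ| - 1`
  have h3 : ((T.card : ℝ) - 1) * (2 * k - T.card - 1) = 0 := by linarith
  rcases mul_eq_zero.1 h3 with h3 | h3
  · obtain ⟨s, hs⟩ := Finset.card_eq_one.1 (show T.card = 1 by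
      have : (T.card : ℝ) = 1 := by linarith
      exact_mod_cast this)
    exact ⟨s, Or.inl (by simp [hs])⟩
  · obtain ⟨s, hs⟩ := Finset.card_eq_one.1 (show Tᶜ.card = 1 by
      have : (T.card : ℝ) + 1 = 2 * k := by linarith
      have : T.card + 1 = 2 * k := by exact_mod_cast this
      rw [Finset.card_compl, card_letter]; omega)
    refine ⟨s, Or.inr ?_⟩
    rw [← compl_compl (T : Set (Letter k)), ← Finset.coe_compl, hs]; simp

/-- The length of `φ n_A` is the total cost of the directions at `1`. -/
theorem length_smul_uniformCurrent (hk : 2 ≤ k) (φ : MulAut (FreeGroup (Fin k))) :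
    (φ • uniformCurrent k hk).length = ∑ s : Letter k, cost φ (sectors {s}) := by
  refine Finset.sum_congr rfl fun s _ => ?_
  have hc : Cyl 1 (letter s) = cut (sectors {s}) := by
    ext q
    rw [mem_cyl_iff]
    have : pre q.1.2 (letter s).norm = letter s ↔ q.1.2 ∈ sectors {s} := by
      rw [← shadow_letter]; rfl
    simp only [inv_one, one_smul, one_mul, this]
    exact ⟨fun h => ⟨fun h' => h.1 (h'.trans h.2.symm), h.2⟩,
      fun h => ⟨fun h' => h.1 (h'.trans h.2), h.2⟩⟩
  change ((nA k).map (bd2Homeo φ)).real (Cyl 1 (letter s)) = _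
  rw [hc, map_measureReal_apply (bd2Homeo φ).continuous.measurable
    (isClopen_cut (isClopen_sectors _)).isOpen.measurableSet]
  rfl

theorem length_uniformCurrent (hk : 2 ≤ k) : (uniformCurrent k hk).length = 1 := by
  have h : ∀ s : Letter k, (uniformCurrent k hk).occ (letter s) = 1 / (2 * k) := fun s => by
    rw [GeodesicCurrent.occ, uniformCurrent_cyl hk (letter_ne_one s).symm, inv_one, one_mul,
      norm_letter]
    simp
  rw [GeodesicCurrent.length, Finset.sum_congr rfl fun s _ => h s, Finset.sum_const,
    Finset.card_univ, card_letter, nsmul_eq_mul]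
  have : (k : ℝ) ≠ 0 := by have : k ≠ 0 := by omega
                           exact_mod_cast this
  push_cast
  field_simp

end cost

/-! ### Clopen sets in the tree -/

section level

variable {k : ℕ}

/-- Membership in `U` depends only on the first `N` letters. -/
def IsLevel (N : ℕ) (U : Set (Boundary k)) : Prop :=
  ∀ ω ω' : Boundary k, pre ω N = pre ω' N → (ω ∈ U ↔ ω' ∈ U)

theorem pre_eq_of_le {ω ω' : Boundary k} {m n : ℕ} (h : m ≤ n) (e : pre ω n = pre ω' n) :
    pre ω m = pre ω' m := by
  have h1 := pre_isPre ω h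
  rw [e] at h1
  exact (h1.of_le (pre_isPre ω' h) (by simp [norm_pre])).eq_of_norm (by simp [norm_pre])

theorem pre_eq_iff {ω ω' : Boundary k} {N : ℕ} :
    pre ω N = pre ω' N ↔ ∀ i < N, ω.1 i = ω'.1 i := by
  rw [← FreeGroup.toWord_inj, toWord_pre, toWord_pre, List.map_inj_left]
  simp

theorem isLevel_iff {N : ℕ} {U : Set (Boundary k)} :
    IsLevel N U ↔ ∃ W : Set (Fin N → Letter k), U = (fun (ω : Boundary k) (i : Fin N) => ω.1 i) ⁻¹' W := by
  constructor
  · intro h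
    refine ⟨(fun (ω : Boundary k) (i : Fin N) => ω.1 i) '' U, (Set.subset_preimage_image _ _).antisymm ?_⟩
    rintro ω ⟨ω', h', e⟩
    exact (h ω' ω (pre_eq_iff.2 fun i hi => congrFun e ⟨i, hi⟩)).1 h'
  · rintro ⟨W, rfl⟩ ω ω' h
    rw [pre_eq_iff] at h
    simp only [Set.mem_preimage]
    rw [show (fun i : Fin N => ω.1 i) = fun i : Fin N => ω'.1 i from funext fun i => h i i.2]

theorem finite_isLevel (N : ℕ) : {U : Set (Boundary k) | IsLevel N U}.Finite := by
  refine (Set.finite_range fun W : Set (Fin N → Letter k) =>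
    (fun (ω : Boundary k) (i : Fin N) => ω.1 i) ⁻¹' W).subset ?_
  intro U hU
  obtain ⟨W, rfl⟩ := isLevel_iff.1 hU
  exact ⟨W, rfl⟩

theorem IsLevel.isClopen {N : ℕ} {U : Set (Boundary k)} (h : IsLevel N U) : IsClopen U := by
  obtain ⟨W, rfl⟩ := isLevel_iff.1 h
  exact (isClopen_discrete W).preimage
    (continuous_pi fun j => (continuous_apply (j : ℕ)).comp continuous_subtype_val)

theorem isLevel_shadow {w : FreeGroup (Fin k)} {N : ℕ} (h : w.norm ≤ N) :
    IsLevel N (shadow w) := fun ω ω' e => by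
  rw [mem_shadow_iff h, mem_shadow_iff h, e]

theorem IsLevel.compl {N : ℕ} {U : Set (Boundary k)} (h : IsLevel N U) : IsLevel N Uᶜ :=
  fun ω ω' e => not_congr (h ω ω' e)

theorem IsLevel.inter {N : ℕ} {U V : Set (Boundary k)} (h : IsLevel N U) (h' : IsLevel N V) :
    IsLevel N (U ∩ V) := fun ω ω' e => and_congr (h ω ω' e) (h' ω ω' e)

theorem isLevel_inv_smul_head {x : FreeGroup (Fin k)} (t : Letter k) {N : ℕ} (h : x.norm < N) :
    IsLevel N {ω : Boundary k | (x⁻¹ • ω).1 0 = t} := by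
  obtain ⟨w, -, hw, e | ⟨e, -⟩⟩ := smul_head_eq_cases x t
  · rw [e]; exact isLevel_shadow (hw.trans h)
  · rw [e]; exact (isLevel_shadow (hw.trans h)).compl

theorem exists_isLevel {U : Set (Boundary k)} (hU : IsClopen U) : ∃ N, IsLevel N U := by
  have hex : ∀ ω : Boundary k, ∃ N, shadow (pre ω N) ⊆ U ∨ shadow (pre ω N) ⊆ Uᶜ := by
    intro ω
    by_cases hω : ω ∈ U
    · obtain ⟨N, hN⟩ := exists_shadow_subset (hU.isOpen.mem_nhds hω)
      exact ⟨N, Or.inl (hN N le_rfl)⟩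
    · obtain ⟨N, hN⟩ := exists_shadow_subset (hU.compl.isOpen.mem_nhds hω)
      exact ⟨N, Or.inr (hN N le_rfl)⟩
  choose n hn using hex
  obtain ⟨T, hT⟩ := isCompact_univ.elim_finite_subcover
    (fun ω : Boundary k => shadow (pre ω (n ω))) (fun ω => isOpen_shadow _)
    (fun ω _ => Set.mem_iUnion.2 ⟨ω, by simp [shadow, norm_pre]⟩)
  refine ⟨T.sup n, fun ω ω' e => ?_⟩
  obtain ⟨η, hη, h1⟩ : ∃ η ∈ T, ω ∈ shadow (pre η (n η)) := by
    simpa using hT (Set.mem_univ ω)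
  have h2 : ω' ∈ shadow (pre η (n η)) :=
    (isLevel_shadow (by rw [norm_pre]; exact Finset.le_sup hη) ω ω' e).1 h1
  rcases hn η with h | h
  · exact iff_of_true (h h1) (h h2)
  · exact iff_of_false (h h1) (h h2)

/-- A vertex of the tree at the boundary of the part where `U` is not constant: either `U` is a
union of directions at `v`, or `U` is constant in every direction at `v` except one direction `f`,
and both values occur outside of `f` as well as in `f`. -/
theorem exists_vertex {N : ℕ} {U : Set (Boundary k)} (hU : IsLevel N U) (hne : U.Nonempty)
    (hne' : Uᶜ.Nonempty) : ∃ v : FreeGroup (Fin k), v.norm < N ∧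
      ((∃ S, {ω | v • ω ∈ U} = sectors S) ∨
        ∃ (f : Letter k) (S : Set (Letter k)), f ∉ S ∧ S.Nonempty ∧ (∃ s, s ∉ S ∧ s ≠ f) ∧
          {ω | v • ω ∈ U} ∩ (sectors {f})ᶜ = sectors S ∧
          ({ω | v • ω ∈ U} ∩ sectors {f}).Nonempty ∧
          ({ω | v • ω ∈ U}ᶜ ∩ sectors {f}).Nonempty) := by
  classical
  let mixed : FreeGroup (Fin k) → Prop := fun v => (shadow v ∩ U).Nonempty ∧ (shadow v ∩ Uᶜ).Nonempty
  have hlt : ∀ v, mixed v → v.norm < N := by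
    rintro v ⟨⟨ω, h1, h2⟩, ω', h3, h4⟩
    by_contra hle
    refine h4 ((hU ω ω' (pre_eq_of_le (not_lt.1 hle) ?_)).1 h2)
    exact (show pre ω v.norm = v from h1).trans (show pre ω' v.norm = v from h3).symm
  have h1 : mixed 1 := by
    have : shadow (1 : FreeGroup (Fin k)) = Set.univ := by
      ext ω; simp [shadow, pre, ← FreeGroup.one_eq_mk]
    simpa [mixed, this] using ⟨hne, hne'⟩
  obtain ⟨v, hv, hmax⟩ : ∃ v, mixed v ∧ ∀ w, mixed w → w.norm ≤ v.norm := by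
    let P : ℕ → Prop := fun n => ∃ v, mixed v ∧ v.norm = n
    have hP : P (Nat.findGreatest P N) :=
      Nat.findGreatest_spec (m := 0) (Nat.zero_le _) ⟨1, h1, by simp⟩
    obtain ⟨v, hv, e⟩ := hP
    refine ⟨v, hv, fun w hw => ?_⟩
    rw [e]
    exact Nat.le_findGreatest (hlt w hw).le ⟨w, hw, rfl⟩
  refine ⟨v, hlt v hv, ?_⟩
  set W := {ω | v • ω ∈ U} with hW
  have hpure : ∀ ω ω' : Boundary k, ω.1 0 = ω'.1 0 → (v * letter (ω.1 0)).norm = v.norm + 1 →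
      ω ∈ W → ω' ∈ W := by
    intro ω ω' e hn h
    by_contra h'
    have hm : mixed (v * letter (ω.1 0)) := by
      refine ⟨⟨v • ω, (inv_smul_head hn _).1 ?_, h⟩, ⟨v • ω', (inv_smul_head hn _).1 ?_, h'⟩⟩
      · rw [inv_smul_smul]
      · rw [inv_smul_smul, e]
    have := hmax _ hm
    omega
  by_cases hv1 : v = 1
  · refine Or.inl ⟨{s | ∃ ω ∈ W, ω.1 0 = s}, Set.ext fun ω => ⟨fun h => ⟨ω, h, rfl⟩, ?_⟩⟩
    rintro ⟨ω', h, e⟩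
    exact hpure ω' ω e (by rw [hv1, one_mul, norm_letter]; simp) h
  obtain ⟨y, l, rfl, hl⟩ := exists_last hv1
  have hgood : ∀ s, s ≠ linv l → (y * letter l * letter s).norm = (y * letter l).norm + 1 := by
    intro s hs
    rcases toWord_mul_letter (y * letter l) s with H | H
    · simp [FreeGroup.norm, H]
    · rw [toWord_mul_letter_of_norm hl] at H
      have := (List.append_inj' H rfl).2
      refine absurd ?_ hs
      rw [show l = linv s by simpa [linv] using this, linv_linv]
  have hsec : ∀ ω : Boundary k, ω.1 0 ≠ linv l →
      (ω ∈ W ↔ ω.1 0 ∈ {s | s ≠ linv l ∧ ∃ ω ∈ W, ω.1 0 = s}) := by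
    refine fun ω hω => ⟨fun h => ⟨hω, ω, h, rfl⟩, ?_⟩
    rintro ⟨-, ω', h, e⟩
    exact hpure ω' ω e (hgood _ (by rwa [e])) h
  generalize hS : {s | s ≠ linv l ∧ ∃ ω ∈ W, ω.1 0 = s} = S at hsec
  have hfS : linv l ∉ S := by rw [← hS]; simp
  by_cases hin : (W ∩ sectors {linv l}).Nonempty
  · by_cases hout : (Wᶜ ∩ sectors {linv l}).Nonempty
    · refine Or.inr ⟨linv l, S, hfS, ?_, ?_, ?_, hin, hout⟩
      · obtain ⟨ω, h2, h3⟩ := hv.1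
        rw [mem_shadow_iff_head hl] at h2
        exact ⟨_, (hsec _ h2).1 (by rw [hW, Set.mem_ofPred_eq, smul_inv_smul]; exact h3)⟩
      · obtain ⟨ω, h2, h3⟩ := hv.2
        rw [mem_shadow_iff_head hl] at h2
        refine ⟨_, fun h => h3 ?_, h2⟩
        have := (hsec _ h2).2 h
        rwa [hW, Set.mem_ofPred_eq, smul_inv_smul] at this
      · ext ω
        constructor
        · rintro ⟨h2, h3⟩
          exact (hsec ω h3).1 h2
        · intro h2
          have h3 : ω.1 0 ≠ linv l := fun e => hfS (by rw [← e]; exact h2)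
          exact ⟨(hsec ω h3).2 h2, h3⟩
    · refine Or.inl ⟨insert (linv l) S, Set.ext fun ω => ?_⟩
      by_cases hω : ω.1 0 = linv l
      · refine iff_of_true ?_ (Or.inl hω)
        by_contra h
        exact hout ⟨ω, h, hω⟩
      · exact (hsec ω hω).trans ⟨Or.inr, fun h => h.resolve_left hω⟩
  · refine Or.inl ⟨S, Set.ext fun ω => ?_⟩
    by_cases hω : ω.1 0 = linv l
    · exact iff_of_false (fun h => hin ⟨ω, h, hω⟩) (fun h => hfS (by rw [← hω]; exact h))
    · exact hsec ω hω

theorem sectors_singleton_nonempty (s : Letter k) : (sectors {s}).Nonempty :=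
  ⟨⟨fun _ => s, fun _ _ => rfl⟩, rfl⟩

theorem sectors_compl (S : Set (Letter k)) : (sectors S)ᶜ = sectors Sᶜ := rfl

theorem sectors_nonempty {S : Set (Letter k)} (hS : S.Nonempty) : (sectors S).Nonempty := by
  obtain ⟨s, hs⟩ := hS
  exact ⟨⟨fun _ => s, fun _ _ => rfl⟩, hs⟩

theorem nonempty_of_sectors {S : Set (Letter k)} (hS : (sectors S).Nonempty) : S.Nonempty := by
  obtain ⟨ω, hω⟩ := hS
  exact ⟨_, hω⟩

theorem cost_one_sectors_singleton (hk : 2 ≤ k) (s : Letter k) :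
    cost 1 (sectors {s}) = 1 / (2 * k : ℝ) := by
  have h := cost_one_sectors hk {s}
  have hk' : (2 : ℝ) ≤ k := by exact_mod_cast hk
  have : (2 * k - 1 : ℝ) ≠ 0 := by linarith
  have : (k : ℝ) ≠ 0 := by linarith
  simp only [Finset.coe_singleton, Finset.card_singleton, Nat.cast_one] at h
  rw [h]
  field_simp

/-- Among nontrivial clopen sets the half-trees have the smallest cost, and they are the only
minimizers. -/
theorem cost_one_lower (hk : 2 ≤ k) {U : Set (Boundary k)} (hU : IsClopen U) (hne : U.Nonempty)
    (hne' : Uᶜ.Nonempty) : 1 / (2 * k : ℝ) ≤ cost 1 U ∧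
      (cost 1 U = 1 / (2 * k : ℝ) → ∃ (v : FreeGroup (Fin k)) (s : Letter k),
        ∀ ω : Boundary k, v • ω ∈ U ↔ ω.1 0 = s) := by
  obtain ⟨N, hN⟩ := exists_isLevel hU
  let A : Set (Set (Boundary k)) := {V | IsLevel N V ∧ V.Nonempty ∧ Vᶜ.Nonempty}
  have hA : A.Finite := (finite_isLevel N).subset fun V hV => hV.1
  -- a set that is not a union of directions at a vertex can be replaced by its part in the only
  -- direction in which it is not constant, without leaving the finite family `A`
  have key : ∀ V ∈ A, (∃ (v : FreeGroup (Fin k)) (S : Set (Letter k)),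
      {ω | v • ω ∈ V} = sectors S) ∨ ∃ V' ∈ A, cost 1 V' < cost 1 V := by
    rintro V ⟨hV, hVn, hVn'⟩
    obtain ⟨v, hvN, h | ⟨f, S, hf, hS, ⟨t, ht, htf⟩, hWS, hin, hout⟩⟩ := exists_vertex hV hVn hVn'
    · exact Or.inl ⟨v, h⟩
    right
    have hW : IsClopen {ω | v • ω ∈ V} := isClopen_smul_preimage v hV.isClopen
    have hcW := cost_smul hk 1 v hV.isClopen
    generalize hWd : {ω | v • ω ∈ V} = W at *
    have h1 : (W \ sectors {f}).Nonempty := by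
      rw [Set.sdiff_eq, hWS]
      exact sectors_nonempty hS
    have h2 : (sectors {f} \ W).Nonempty := by
      rw [Set.sdiff_eq, Set.inter_comm]; exact hout
    have hsub := cost_inter_add_cost_union_lt hk 1 hW (isClopen_sectors {f}) h1 h2
    have hun : W ∪ sectors {f} = sectors (insert f S) := by
      ext ω
      have := Set.ext_iff.1 hWS ω
      simp only [sectors, Set.mem_inter_iff, Set.mem_union, Set.mem_compl_iff, Set.mem_ofPred_eq,
        Set.mem_singleton_iff, Set.mem_insert_iff] at this ⊢
      tauto
    have hlow := (cost_one_sectors_lower hk (S := insert f S) ⟨f, Or.inl rfl⟩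
      ⟨t, fun h => h.elim htf ht⟩).1
    rw [hun, cost_one_sectors_singleton hk f] at hsub
    have hD : IsClopen (W ∩ sectors {f}) := hW.inter (isClopen_sectors _)
    refine ⟨{ω | v⁻¹ • ω ∈ W ∩ sectors {f}}, ⟨?_, ?_, ?_⟩, ?_⟩
    · have e : {ω | v⁻¹ • ω ∈ W ∩ sectors {f}} = V ∩ {ω | (v⁻¹ • ω).1 0 = f} := by
        ext ω
        simp [← hWd, sectors]
      rw [e]
      exact hV.inter (isLevel_inv_smul_head f hvN)
    · obtain ⟨ω, hω⟩ := hin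
      exact ⟨v • ω, by simpa using hω⟩
    · obtain ⟨ω, -, hω⟩ := h1
      exact ⟨v • ω, fun h => hω (by simpa using h.2)⟩
    · rw [cost_smul hk 1 _ hD]
      linarith
  have hsect : ∀ (V : Set (Boundary k)), V ∈ A → ∀ (v : FreeGroup (Fin k)) (S : Set (Letter k)),
      {ω | v • ω ∈ V} = sectors S → S.Nonempty ∧ Sᶜ.Nonempty ∧ cost 1 V = cost 1 (sectors S) := by
    rintro V ⟨hV, ⟨ω, hω⟩, ω', hω'⟩ v S e
    refine ⟨nonempty_of_sectors ⟨v⁻¹ • ω, ?_⟩, nonempty_of_sectors ⟨v⁻¹ • ω', ?_⟩, ?_⟩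
    · rw [← e]; simpa using hω
    · rw [← sectors_compl, ← e]; simpa using hω'
    · rw [← e, cost_smul hk 1 v hV.isClopen]
  have hlow : ∀ V ∈ A, 1 / (2 * k : ℝ) ≤ cost 1 V := by
    intro V hV
    obtain ⟨V₀, hV₀, hmin⟩ := Set.exists_min_image A (cost 1) hA ⟨V, hV⟩
    rcases key V₀ hV₀ with ⟨v, S, e⟩ | ⟨V', hV', hlt⟩
    · obtain ⟨h1, h2, h3⟩ := hsect V₀ hV₀ v S e
      exact ((cost_one_sectors_lower hk h1 h2).1.trans_eq h3.symm).trans (hmin V hV)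
    · exact absurd (hmin V' hV') (not_le.2 hlt)
  refine ⟨hlow U ⟨hN, hne, hne'⟩, fun heq => ?_⟩
  rcases key U ⟨hN, hne, hne'⟩ with ⟨v, S, e⟩ | ⟨V', hV', hlt⟩
  · obtain ⟨h1, h2, h3⟩ := hsect U ⟨hN, hne, hne'⟩ v S e
    obtain ⟨s, rfl | rfl⟩ := (cost_one_sectors_lower hk h1 h2).2 (h3.symm.trans heq)
    · exact ⟨v, s, fun ω => Set.ext_iff.1 e ω⟩
    · -- the complement of a direction is a direction at the neighbouring vertex
      refine ⟨v * letter s, linv s, fun ω => ?_⟩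
      have h4 : v • (letter s • ω) ∈ U ↔ (letter s • ω).1 0 ≠ s := Set.ext_iff.1 e (letter s • ω)
      rw [mul_smul, h4, ne_eq, letter_smul_head, not_not]
  · exact absurd (hlow V' hV') (not_le.2 (heq ▸ hlt))

theorem cost_lower (hk : 2 ≤ k) (φ : MulAut (FreeGroup (Fin k))) {U : Set (Boundary k)}
    (hU : IsClopen U) (hne : U.Nonempty) (hne' : Uᶜ.Nonempty) : 1 / (2 * k : ℝ) ≤ cost φ U := by
  rw [cost_eq_cost_one]
  exact (cost_one_lower hk (isClopen_preimage_bdHomeo φ hU)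
    (hne.preimage (bdHomeo φ).surjective) (hne'.preimage (bdHomeo φ).surjective)).1

theorem one_letter_ne (hk : 2 ≤ k) (s t : Letter k) : ∃ u, u ≠ s ∧ u ≠ t := by
  classical
  have h : ({s, t} : Finset (Letter k)).card < (Finset.univ : Finset (Letter k)).card := by
    rw [Finset.card_univ, card_letter]
    exact (Finset.card_le_two).trans_lt (by omega)
  obtain ⟨u, -, hu⟩ := Finset.exists_mem_notMem_of_card_lt_card h
  exact ⟨u, by simpa using hu⟩

theorem sectors_compl_singleton_nonempty (hk : 2 ≤ k) (s : Letter k) :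
    (sectors {s} : Set (Boundary k))ᶜ.Nonempty := by
  obtain ⟨u, hu, -⟩ := one_letter_ne hk s s
  exact sectors_nonempty (S := {s}ᶜ) ⟨u, hu⟩

theorem one_le_length (hk : 2 ≤ k) (φ : MulAut (FreeGroup (Fin k))) :
    1 ≤ (φ • uniformCurrent k hk).length := by
  rw [length_smul_uniformCurrent]
  have h := Finset.sum_le_sum fun (s : Letter k) (_ : s ∈ Finset.univ) =>
    cost_lower hk φ (isClopen_sectors {s}) (sectors_singleton_nonempty s)
      (sectors_compl_singleton_nonempty hk s)
  rw [Finset.sum_const, Finset.card_univ, card_letter, nsmul_eq_mul] at h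
  have : (k : ℝ) ≠ 0 := by
    have : k ≠ 0 := by omega
    exact_mod_cast this
  refine le_trans (le_of_eq ?_) h
  push_cast
  field_simp

end level

/-! ### Automorphisms of minimal cost are simple -/

section simple

variable {k : ℕ}

theorem ConvergesTo.mul_right {u : ℕ → FreeGroup (Fin k)} {ω : Boundary k} (h : ConvergesTo u ω)
    (g : FreeGroup (Fin k)) : ConvergesTo (fun n => u n * g) ω := by
  intro i
  filter_upwards [h i, convergesTo_iff.1 h (i + g.norm + 1)] with n h1 h2
  have := h2.norm_le
  rw [norm_pre] at this
  rw [getElem?_mul _ _ (by omega), h1]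

theorem bdHomeo_conj (g : FreeGroup (Fin k)) (ω : Boundary k) :
    bdHomeo (MulAut.conj g) ω = g • ω := by
  have h1 : ConvergesTo (fun n => MulAut.conj g (pre ω n)) (bdMap (MulAut.conj g) ω) :=
    bdMap_spec (extends_aut _) ω
  simp only [MulAut.conj_apply] at h1
  exact h1.unique (((convergesTo_pre ω).smul g).mul_right g⁻¹)

theorem head_of_mem_shadow {w : FreeGroup (Fin k)} (hw : w ≠ 1) {ω : Boundary k}
    (h : ω ∈ shadow w) : w.toWord[0]? = some (ω.1 0) := by
  have h1 := head_pre ω (n := w.norm) (Nat.pos_of_ne_zero (by simpa using hw))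
  rwa [show pre ω w.norm = w from h] at h1

theorem mA_real_shadow (hk : 2 ≤ k) {u : FreeGroup (Fin k)} (hu : u ≠ 1) :
    (mA k).real (shadow u) = 1 / (2 * k) * (1 / (2 * k - 1)) ^ (u.norm - 1) := by
  rw [measureReal_def, mA_shadow hk hu, ENNReal.toReal_mul, ENNReal.toReal_pow, ENNReal.toReal_inv,
    ENNReal.toReal_inv, ENNReal.toReal_natCast, ENNReal.toReal_natCast]
  have : 1 ≤ 2 * k := by omega
  push_cast [this]
  simp

theorem mA_real_shadow_bounds (hk : 2 ≤ k) {u : FreeGroup (Fin k)} (hu : u ≠ 1) :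
    0 < (mA k).real (shadow u) ∧ (mA k).real (shadow u) ≤ 1 / (2 * k) ∧
      ((mA k).real (shadow u) = 1 / (2 * k) → ∃ c, u = letter c) := by
  have hk' : (2 : ℝ) ≤ k := by exact_mod_cast hk
  have h0 : (0 : ℝ) < 1 / (2 * k) := by apply one_div_pos.2; linarith
  have h1 : (0 : ℝ) < 1 / (2 * k - 1) := by apply one_div_pos.2; linarith
  have h2 : (1 / (2 * k - 1) : ℝ) < 1 := by rw [div_lt_one] <;> linarith
  rw [mA_real_shadow hk hu]
  refine ⟨by positivity, mul_le_of_le_one_right h0.le (pow_le_one₀ h1.le h2.le), fun h => ?_⟩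
  have h3 : (1 / (2 * k - 1) : ℝ) ^ (u.norm - 1) = 1 := by
    rwa [mul_eq_left₀ h0.ne'] at h
  have h4 : u.norm - 1 = 0 := by
    by_contra hne
    exact (pow_lt_one₀ h1.le h2 hne).ne h3
  have h5 : u.norm ≠ 0 := by simpa using hu
  obtain ⟨c, hc⟩ := List.length_eq_one_iff.1 (show u.toWord.length = 1 by
    rw [FreeGroup.norm] at h4 h5; omega)
  exact ⟨c, by rw [← FreeGroup.mk_toWord (x := u), hc]; rfl⟩

theorem eq_letter_of_shadow_eq (hk : 2 ≤ k) {w : FreeGroup (Fin k)} (hw : w ≠ 1) {p : Letter k}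
    (h : shadow w = sectors {p}) : w = letter p := by
  obtain ⟨c, rfl⟩ := (mA_real_shadow_bounds hk hw).2.2 (by
    rw [h, ← shadow_letter, mA_real_shadow hk (letter_ne_one p), norm_letter]; simp)
  rw [shadow_letter] at h
  obtain ⟨ω, hω⟩ := sectors_singleton_nonempty c
  have h2 : ω ∈ sectors {p} := h ▸ hω
  rw [show c = p from (show ω.1 0 = c from hω).symm.trans h2]

/-- If the boundary map permutes the directions at `1`, the automorphism permutes the letters. -/
theorem isRelabelling_of_head (hk : 2 ≤ k) (ψ : MulAut (FreeGroup (Fin k)))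
    (r : Letter k → Letter k) (h : ∀ s ω, (bdHomeo ψ ω).1 0 = s ↔ ω.1 0 = r s) :
    IsRelabelling ψ := by
  have hinj : Function.Injective r := by
    intro s s' e
    obtain ⟨ω, hω⟩ := sectors_singleton_nonempty (r s)
    exact ((h s ω).2 hω).symm.trans ((h s' ω).2 (e ▸ hω))
  let R : Equiv.Perm (Letter k) := Equiv.ofBijective r (Finite.injective_iff_bijective.1 hinj)
  have hR : ∀ c, r (R.symm c) = c := fun c => Equiv.apply_symm_apply R c
  let I : Equiv.Perm (Letter k) := ⟨linv, linv, linv_linv, linv_linv⟩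
  refine ⟨I.trans (R.symm.trans I), fun c => ?_⟩
  change ψ (letter c) = letter (linv (R.symm (linv c)))
  set p := R.symm (linv c) with hp
  set s := R.symm c with hs
  set y := ψ (letter c) with hy
  -- both sides describe the image of the half-tree at `1` in the direction `c`
  have key : {ξ : Boundary k | ((y⁻¹)⁻¹ • ξ).1 0 = s} = (sectors {p})ᶜ := by
    ext ξ
    obtain ⟨ω, rfl⟩ := (bdHomeo ψ).surjective ξ
    have h1 : y • bdHomeo ψ ω = bdHomeo ψ (letter c • ω) := (bdHomeo_smul ψ _ ω).symm
    rw [inv_inv, Set.mem_ofPred_eq, h1, h, hs, hR, letter_smul_head]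
    exact not_congr (by rw [← hR (linv c), ← h]; rfl)
  obtain ⟨w, hw, -, e | ⟨e, rfl⟩⟩ := smul_head_eq_cases y⁻¹ s
  · exfalso
    rw [key] at e
    obtain ⟨u, hu, -⟩ := one_letter_ne hk p p
    obtain ⟨u', hu', huu'⟩ := one_letter_ne hk p u
    have h1 := head_of_mem_shadow hw (ω := ⟨fun _ => u, fun _ _ => rfl⟩) (by rw [← e]; exact hu)
    have h2 := head_of_mem_shadow hw (ω := ⟨fun _ => u', fun _ _ => rfl⟩) (by rw [← e]; exact hu')
    exact huu' (Option.some_injective _ (h2.symm.trans h1))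
  · rw [key, compl_inj_iff] at e
    rw [letter_linv, ← eq_letter_of_shadow_eq hk hw e.symm, inv_inv]

/-- A partition of `∂F` into `2k` half-trees, one of which is a direction at `1`, is the partition
into the directions at `1`. For the uniform measure on `∂F`, no shadow has more than the measure
`1 / (2k)` of a direction at `1`, only those directions attain it, and the complement of a shadow
leaves too little room for the other sets of the partition. -/
theorem exists_sectors_of_partition (hk : 2 ≤ k) (R : Letter k → Set (Boundary k))
    (hR : ∀ ω, ∃! s, ω ∈ R s)
    (hw : ∀ s, ∃ w : FreeGroup (Fin k), w ≠ 1 ∧ (R s = shadow w ∨ R s = (shadow w)ᶜ))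
    {s₀ t₀ : Letter k} (h₀ : R s₀ = sectors {t₀}) (s : Letter k) : ∃ c, R s = sectors {c} := by
  have := isFiniteMeasure_mA hk
  have hk' : (2 : ℝ) ≤ k := by exact_mod_cast hk
  have hsmall : (1 / (2 * k) : ℝ) ≤ 1 / 4 := by
    apply one_div_le_one_div_of_le <;> linarith
  have hm : ∀ w : FreeGroup (Fin k), MeasurableSet (shadow w) :=
    fun w => (isOpen_shadow w).measurableSet
  have hpart : ∀ Q : Letter k → Set (Boundary k), (∀ s, MeasurableSet (Q s)) →
      (∀ ω, ∃! s, ω ∈ Q s) → ∑ s, (mA k).real (Q s) = (mA k).real Set.univ := by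
    intro Q hQ hu
    rw [← measureReal_biUnion_finset]
    · congr 1
      exact Set.eq_univ_of_forall fun ω => by
        obtain ⟨s, hs, -⟩ := hu ω
        exact Set.mem_biUnion (Finset.mem_coe.2 (Finset.mem_univ s)) hs
    · intro s _ s' _ hne
      exact Set.disjoint_left.2 fun ω h1 h2 => hne ((hu ω).unique h1 h2)
    · exact fun s _ => hQ s
  have h0 : ∀ t : Letter k, (mA k).real (sectors {t}) = 1 / (2 * k) := fun t => by
    rw [← shadow_letter, mA_real_shadow hk (letter_ne_one t), norm_letter]; simp
  have huniv : (mA k).real Set.univ = 1 := by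
    rw [← hpart (fun s => sectors {s}) (fun s => (isClopen_sectors _).isOpen.measurableSet)
      (fun ω => ⟨ω.1 0, rfl, fun s hs => Eq.symm hs⟩), Finset.sum_congr rfl fun s _ => h0 s,
      Finset.sum_const, Finset.card_univ, card_letter, nsmul_eq_mul]
    push_cast
    field_simp
  have hRm : ∀ s, MeasurableSet (R s) := fun s => by
    obtain ⟨w, -, h | h⟩ := hw s
    · rw [h]; exact hm w
    · rw [h]; exact (hm w).compl
  have hsum := (hpart R hRm hR).trans huniv
  have hbig : ∀ w : FreeGroup (Fin k), w ≠ 1 → 1 - 1 / (2 * k) ≤ (mA k).real (shadow w)ᶜ := by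
    intro w h1
    rw [measureReal_compl (hm w), huniv]
    have := (mA_real_shadow_bounds hk h1).2.1
    linarith
  have hpos : ∀ s, 0 < (mA k).real (R s) := fun s => by
    obtain ⟨w, h1, h | h⟩ := hw s
    · rw [h]; exact (mA_real_shadow_bounds hk h1).1
    · rw [h]; exact lt_of_lt_of_le (by linarith) (hbig w h1)
  have hle : ∀ s, (mA k).real (R s) ≤ 1 / (2 * k) := by
    intro s
    obtain ⟨w, h1, h | h⟩ := hw s
    · rw [h]; exact (mA_real_shadow_bounds hk h1).2.1
    · by_cases hs : s = s₀
      · rw [hs, h₀, h0]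
      · exfalso
        classical
        obtain ⟨u, hu, hu'⟩ := one_letter_ne hk s s₀
        have h2 := Finset.sum_le_sum_of_subset_of_nonneg
          (f := fun s => (mA k).real (R s)) (Finset.subset_univ {s, s₀, u})
          fun _ _ _ => measureReal_nonneg
        rw [hsum, Finset.sum_insert (by simp [hs, hu.symm]), Finset.sum_insert (by simp [hu'.symm]),
          Finset.sum_singleton, h₀, h0, h] at h2
        have := hpos u
        have := hbig w h1
        linarith
  have hall : (mA k).real (R s) = 1 / (2 * k) := by
    have h1 : ∑ s, (1 / (2 * k : ℝ) - (mA k).real (R s)) = 0 := by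
      rw [Finset.sum_sub_distrib, hsum, Finset.sum_const, Finset.card_univ, card_letter,
        nsmul_eq_mul]
      push_cast
      field_simp
      simp
    have := (Finset.sum_eq_zero_iff_of_nonneg fun s _ => sub_nonneg.2 (hle s)).1 h1 s
      (Finset.mem_univ s)
    linarith
  obtain ⟨w, h1, h | h⟩ := hw s
  · rw [h] at hall
    obtain ⟨c, rfl⟩ := (mA_real_shadow_bounds hk h1).2.2 hall
    exact ⟨c, by rw [h, shadow_letter]⟩
  · rw [h] at hall
    have := hbig w h1
    linarith

theorem isSimple_of_cost_eq (hk : 2 ≤ k) (φ : MulAut (FreeGroup (Fin k)))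
    (h : ∀ s : Letter k, cost φ (sectors {s}) = 1 / (2 * k)) : IsSimple φ := by
  have h1 : ∀ s, ∃ (v : FreeGroup (Fin k)) (t : Letter k), ∀ ω : Boundary k,
      (bdHomeo φ (v • ω)).1 0 = s ↔ ω.1 0 = t := by
    intro s
    have hc := isClopen_sectors (k := k) {s}
    refine (cost_one_lower hk (isClopen_preimage_bdHomeo φ hc)
      ((sectors_singleton_nonempty s).preimage (bdHomeo φ).surjective)
      ((sectors_compl_singleton_nonempty hk s).preimage (bdHomeo φ).surjective)).2 ?_
    rw [← cost_eq_cost_one, h]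
  choose v t hvt using h1
  let s₀ : Letter k := (⟨0, by omega⟩, true)
  -- translating by `g` makes the preimage of `s₀` a direction at `1`
  set g := v s₀ with hg
  have h2 : ∀ s, ∃ c, {ω : Boundary k | (bdHomeo φ (g • ω)).1 0 = s} = sectors {c} := by
    refine exists_sectors_of_partition hk _ (fun ω => ⟨_, rfl, fun s hs => Eq.symm hs⟩) (fun s => ?_)
      (s₀ := s₀) (t₀ := t s₀) (Set.ext fun ω => hvt s₀ ω)
    obtain ⟨w, hw, -, e⟩ := smul_head_eq_cases (g⁻¹ * v s) (t s)
    have e' : {ω : Boundary k | (bdHomeo φ (g • ω)).1 0 = s} =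
        {ω | ((g⁻¹ * v s)⁻¹ • ω).1 0 = t s} := by
      ext ω
      rw [Set.mem_ofPred_eq, Set.mem_ofPred_eq, ← hvt s, smul_smul]
      simp
    rw [e']
    exact ⟨w, hw, e.imp id And.left⟩
  choose r hr using h2
  have hrel : IsRelabelling (φ * MulAut.conj g) := by
    refine isRelabelling_of_head hk _ r fun s ω => ?_
    rw [bdHomeo_mul, bdHomeo_conj]
    exact Set.ext_iff.1 (hr s) ω
  refine ⟨φ g⁻¹, _, hrel, MulEquiv.ext fun x => ?_⟩
  simp [mul_assoc]

end simple

/-! ### Whitehead automorphisms and their boundary maps -/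

section whitehead

variable {k : ℕ}

theorem letter_hom_ext {f f' : FreeGroup (Fin k) →* FreeGroup (Fin k)}
    (h : ∀ s, f (letter s) = f' (letter s)) : f = f' :=
  FreeGroup.ext_hom _ _ fun i => h (i, true)

/-- The endomorphism that sends each letter `x` to `(e x)⁻¹ x (e x⁻¹)`. -/
noncomputable def twist (e : Letter k → FreeGroup (Fin k)) :
    FreeGroup (Fin k) →* FreeGroup (Fin k) :=
  FreeGroup.lift fun i => (e (i, true))⁻¹ * letter (i, true) * e (i, false)

theorem twist_letter (e : Letter k → FreeGroup (Fin k)) (x : Letter k) :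
    twist e (letter x) = (e x)⁻¹ * letter x * e (linv x) := by
  have h : ∀ i, twist e (letter (i, true)) =
      (e (i, true))⁻¹ * letter (i, true) * e (i, false) := fun i => FreeGroup.lift_apply_of
  obtain ⟨i, _ | _⟩ := x
  · have h1 : letter (i, false) = (letter (i, true))⁻¹ := letter_linv (i, true)
    rw [h1, map_inv, h]
    simp [linv, mul_assoc]
  · exact h i

/-- The multiplier `a` for the letters of `T`, and `1` for the other letters. -/
noncomputable def mult (a : Letter k) (T : Set (Letter k)) (x : Letter k) : FreeGroup (Fin k) :=
  open Classical in if x ∈ T then letter a else 1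

theorem twist_mult_self {a : Letter k} {T : Set (Letter k)} (ha : a ∉ T) (ha' : linv a ∉ T) :
    twist (mult a T) (letter a) = letter a := by
  simp [twist_letter, mult, ha, ha']

theorem twist_mult_inv_self {a : Letter k} {T : Set (Letter k)} (ha : a ∉ T) (ha' : linv a ∉ T) :
    twist (fun x => (mult a T x)⁻¹) (letter a) = letter a := by
  simp [twist_letter, mult, ha, ha']

/-- The Whitehead automorphism with multiplier `a` that sends a letter `x` to
`a ^ (-[x ∈ T]) * x * a ^ [x⁻¹ ∈ T]`. -/
noncomputable def whitehead (a : Letter k) (T : Set (Letter k)) (ha : a ∉ T) (ha' : linv a ∉ T) :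
    MulAut (FreeGroup (Fin k)) :=
  MonoidHom.toMulEquiv (twist (mult a T)) (twist fun x => (mult a T x)⁻¹)
    (letter_hom_ext fun s => by
      have h : ∀ x, twist (fun x => (mult a T x)⁻¹) (mult a T x) = mult a T x := fun x => by
        rw [mult]
        split_ifs
        · exact twist_mult_inv_self ha ha'
        · simp
      simp only [MonoidHom.comp_apply, twist_letter, map_mul, map_inv, h, MonoidHom.id_apply]
      group)
    (letter_hom_ext fun s => by
      have h : ∀ x, twist (mult a T) (mult a T x) = mult a T x := fun x => by
        conv_lhs => rw [mult]
        conv_rhs => rw [mult]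
        split_ifs
        · exact twist_mult_self ha ha'
        · simp
      simp only [MonoidHom.comp_apply, twist_letter, map_mul, map_inv, h, MonoidHom.id_apply]
      group)

variable {a : Letter k} {T : Set (Letter k)} (ha : a ∉ T) (ha' : linv a ∉ T)

theorem whitehead_letter (x : Letter k) : whitehead a T ha ha' (letter x) =
    (mult a T x)⁻¹ * letter x * mult a T (linv x) := twist_letter _ x

theorem whitehead_self : whitehead a T ha ha' (letter a) = letter a := twist_mult_self ha ha'

theorem isWhiteheadSecondKind_whitehead : IsWhiteheadSecondKind (whitehead a T ha ha') := by
  refine ⟨a, fun x => ?_⟩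
  rw [whitehead_letter, mult, mult]
  split_ifs <;> simp

/-- The elements whose image under the Whitehead automorphism starts with `x`; see
`head_whitehead`. -/
def Piece (a : Letter k) (T : Set (Letter k)) (x : Letter k) (g : FreeGroup (Fin k)) : Prop :=
  (x = a ∧ ∀ s ∈ insert (linv a) T, ((letter a)⁻¹ * g).toWord[0]? ≠ some s) ∨
  (x = linv a ∧ ∃ s ∈ insert (linv a) T, g.toWord[0]? = some s) ∨
  (x ∈ T ∧ ((letter a)⁻¹ * g).toWord[0]? = some x) ∨
  (x ∉ T ∧ x ≠ a ∧ x ≠ linv a ∧ g.toWord[0]? = some x)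

theorem exists_piece {g : FreeGroup (Fin k)} (hg : g ≠ 1) : ∃ x, Piece a T x g := by
  obtain ⟨s, hs⟩ := head_ne_none hg
  by_cases h1 : s ∈ insert (linv a) T
  · exact ⟨linv a, Or.inr (Or.inl ⟨rfl, s, h1, hs⟩)⟩
  by_cases h2 : s = a
  · by_cases h3 : ∃ t ∈ insert (linv a) T, ((letter a)⁻¹ * g).toWord[0]? = some t
    · obtain ⟨t, rfl | ht, h4⟩ := h3
      · have h5 := head_letter_mul a ((letter a)⁻¹ * g)
        rw [mul_inv_cancel_left, hs, h2] at h5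
        exact absurd h4 (h5.1 rfl)
      · exact ⟨t, Or.inr (Or.inr (Or.inl ⟨ht, h4⟩))⟩
    · push Not at h3
      exact ⟨a, Or.inl ⟨rfl, h3⟩⟩
  · rw [Set.mem_insert_iff, not_or] at h1
    exact ⟨s, Or.inr (Or.inr (Or.inr ⟨h1.2, h2, h1.1, hs⟩))⟩

/-- The word length in which the letters `a` and `a⁻¹` count once and all others twice. -/
def weight (a : Letter k) (g : FreeGroup (Fin k)) : ℕ :=
  (g.toWord.map fun s => if s.1 = a.1 then 1 else 2).sum

theorem weight_self_mul_le (a : Letter k) (g : FreeGroup (Fin k)) :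
    weight a (letter a * g) ≤ weight a g + 1 := by
  rcases toWord_letter_mul a g with ⟨-, h⟩ | h
  · simp [weight, h, add_comm]
  · simp only [weight, h, List.map_cons, List.sum_cons]
    omega

theorem exists_tail {g : FreeGroup (Fin k)} {x : Letter k} (h : g.toWord[0]? = some x) :
    ∃ g', g = letter x * g' ∧ g'.toWord[0]? ≠ some (linv x) ∧ g.toWord = x :: g'.toWord := by
  have e : g = letter x * ((letter x)⁻¹ * g) := by simp
  have h1 : ((letter x)⁻¹ * g).toWord[0]? ≠ some (linv x) := by
    rw [← head_letter_mul, ← e, h]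
  refine ⟨_, e, h1, ?_⟩
  rcases toWord_letter_mul x ((letter x)⁻¹ * g) with ⟨-, h2⟩ | h2
  · rwa [← e] at h2
  · exact absurd (by rw [h2]; rfl) h1

theorem weight_eq_of_tail {g g' : FreeGroup (Fin k)} {x : Letter k} (h : g.toWord = x :: g'.toWord) :
    weight a g = (if x.1 = a.1 then 1 else 2) + weight a g' := by
  simp [weight, h]

theorem fst_ne_of_ne {x a : Letter k} (h : x ≠ a) (h' : x ≠ linv a) : x.1 ≠ a.1 := by
  intro e
  by_cases h2 : x.2 = a.2
  · exact h (Prod.ext e h2)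
  · exact h' (Prod.ext e (Bool.eq_not.2 h2))

/-- The first letter of the image of a word under a Whitehead automorphism. The induction is on the
weight, because an occurrence of `x` may be traded for an occurrence of `a`. -/
theorem head_whitehead (g : FreeGroup (Fin k)) : ∀ x, Piece a T x g →
    (whitehead a T ha ha' g).toWord[0]? = some x := by
  induction hn : weight a g using Nat.strong_induction_on generalizing g with
  | _ n ih =>
  subst hn
  set τ := whitehead a T ha ha' with hτ
  have hτa : τ (letter a) = letter a := whitehead_self ha ha'
  have aux : ∀ h z, weight a h < weight a g → ¬ Piece a T z h → (τ h).toWord[0]? ≠ some z := by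
    intro h z hw hz hc
    by_cases h1 : h = 1
    · simp [h1] at hc
    · obtain ⟨y, hy⟩ := exists_piece (a := a) (T := T) h1
      have := ih _ hw h rfl y hy
      rw [hc, Option.some_inj] at this
      exact hz (this ▸ hy)
  have step : ∀ x g', x ≠ a → x ≠ linv a → g'.toWord[0]? ≠ some (linv x) →
      weight a g' + 2 ≤ weight a g →
      (letter x * (mult a T (linv x) * τ g')).toWord[0]? = some x := by
    intro x g' hx hx' hg' hw
    have e : mult a T (linv x) * τ g' = τ (mult a T (linv x) * g') := by
      rw [map_mul, mult]; split_ifs <;> simp [hτa]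
    have hxa : linv x ≠ a := fun h => hx' (by rw [← h, linv_linv])
    have hxa' : linv x ≠ linv a := linv_injective.ne hx
    rw [head_letter_mul, e]
    by_cases hT : linv x ∈ T
    · have hm : mult a T (linv x) = letter a := if_pos hT
      have := weight_self_mul_le a g'
      rw [hm]
      refine aux _ _ (by omega) ?_
      rintro (⟨h, -⟩ | ⟨h, -⟩ | ⟨-, h⟩ | ⟨h, -⟩)
      · exact hxa h
      · exact hxa' h
      · rw [inv_mul_cancel_left] at h; exact hg' h
      · exact h hT
    · have hm : mult a T (linv x) = 1 := if_neg hT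
      rw [hm, one_mul]
      refine aux _ _ (by omega) ?_
      rintro (⟨h, -⟩ | ⟨h, -⟩ | ⟨h, -⟩ | ⟨-, -, -, h⟩)
      · exact hxa h
      · exact hxa' h
      · exact hT h
      · exact hg' h
  have hneT : ∀ {x}, x ∈ T → x ≠ a ∧ x ≠ linv a := fun hx =>
    ⟨fun h => ha (h ▸ hx), fun h => ha' (h ▸ hx)⟩
  rintro x (⟨rfl, h⟩ | ⟨rfl, s, hs, h⟩ | ⟨hx, h⟩ | ⟨hx, hxa, hxa', h⟩)
  · -- `g = x g'` where `g'` starts neither with `x⁻¹` nor in `T`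
    set g' := (letter x)⁻¹ * g with hg'
    have e : g = letter x * g' := by simp [hg']
    have hhd : g.toWord[0]? = some x := by
      rw [e, head_letter_mul]; exact h _ (Or.inl rfl)
    obtain ⟨g'', e', -, hw⟩ := exists_tail hhd
    obtain rfl : g'' = g' := mul_left_cancel (e'.symm.trans e)
    have hwt := weight_eq_of_tail (a := x) hw
    rw [e, map_mul, hτa, head_letter_mul]
    refine aux _ _ (by rw [hwt]; simp) ?_
    rintro (⟨h1, -⟩ | ⟨-, s, hs, h1⟩ | ⟨h1, -⟩ | ⟨-, -, h1, -⟩)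
    · exact linv_ne x h1
    · exact h s hs h1
    · exact ha' h1
    · exact h1 rfl
  · obtain ⟨g', e, h1, hw⟩ := exists_tail h
    have hwt := weight_eq_of_tail (a := a) hw
    rcases hs with rfl | hs
    · have e1 : τ g = letter (linv a) * τ g' := by
        rw [e, map_mul, letter_linv, map_inv, hτa]
      rw [e1, head_letter_mul, linv_linv]
      rw [linv_linv] at h1
      refine aux _ _ (by rw [hwt]; simp [linv]) ?_
      rintro (⟨-, h2⟩ | ⟨h2, -⟩ | ⟨h2, -⟩ | ⟨-, h2, -⟩)
      · -- `a⁻¹ * g'` starts with `a⁻¹`, as `g'` does not start with `a`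
        refine h2 _ (Or.inl rfl) ?_
        rw [← letter_linv, head_letter_mul, linv_linv]
        exact h1
      · exact linv_ne a h2.symm
      · exact ha h2
      · exact h2 rfl
    · obtain ⟨hsa, hsa'⟩ := hneT hs
      rw [if_neg (fst_ne_of_ne hsa hsa')] at hwt
      have hst := step s g' hsa hsa' h1 (by omega)
      have hm : mult a T s = letter a := if_pos hs
      have e1 : τ g = letter (linv a) * (letter s * (mult a T (linv s) * τ g')) := by
        rw [e, map_mul, hτ, whitehead_letter, hm, letter_linv]
        simp only [mul_assoc]
      rw [e1, head_letter_mul, hst, linv_linv]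
      simpa using hsa
  · obtain ⟨hxa, hxa'⟩ := hneT hx
    obtain ⟨g', e, h1, hw⟩ := exists_tail h
    have hwt := weight_eq_of_tail (a := a) hw
    rw [if_neg (fst_ne_of_ne hxa hxa')] at hwt
    have hle : weight a ((letter a)⁻¹ * g) ≤ weight a g := by
      rcases toWord_letter_mul (linv a) g with ⟨-, h2⟩ | h2
      · rw [← letter_linv, h2] at h
        exact absurd (by simpa using h.symm) hxa'
      · rw [letter_linv] at h2
        simp only [weight, h2, List.map_cons, List.sum_cons]
        omega
    have hm : mult a T x = letter a := if_pos hx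
    have e1 : τ g = letter x * (mult a T (linv x) * τ g') := by
      have e2 : g = letter a * (letter x * g') := by rw [← e, mul_inv_cancel_left]
      rw [e2, map_mul, map_mul, hτa, hτ, whitehead_letter, hm]
      simp only [mul_assoc, mul_inv_cancel_left]
    rw [e1]
    exact step x g' hxa hxa' h1 (by omega)
  · obtain ⟨g', e, h1, hw⟩ := exists_tail h
    have hwt := weight_eq_of_tail (a := a) hw
    rw [if_neg (fst_ne_of_ne hxa hxa')] at hwt
    have hm : mult a T x = 1 := if_neg hx
    have e1 : τ g = letter x * (mult a T (linv x) * τ g') := by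
      rw [e, map_mul, hτ, whitehead_letter, hm]
      simp only [inv_one, one_mul, mul_assoc]
    rw [e1]
    exact step x g' hxa hxa' h1 (by omega)

theorem bdHomeo_head_of_piece {ω : Boundary k} {x : Letter k} {u : ℕ → FreeGroup (Fin k)}
    (hu : ConvergesTo u ω) (h : ∀ᶠ n in atTop, Piece a T x (u n)) :
    (bdHomeo (whitehead a T ha ha') ω).1 0 = x :=
  (hu.bdMap (extends_aut _)).head_eq (h.mono fun _ hn => head_whitehead ha ha' _ x hn).frequently

/-- The four kinds of preimages of directions at `1` under the boundary map of a Whitehead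
automorphism. -/
theorem bdHomeo_whitehead_head (ω : Boundary k) (x : Letter k) :
    (bdHomeo (whitehead a T ha ha') ω).1 0 = x ↔
      (x = a ∧ ((letter a)⁻¹ • ω).1 0 ∉ insert (linv a) T) ∨
      (x = linv a ∧ ω.1 0 ∈ insert (linv a) T) ∨
      (x ∈ T ∧ ((letter a)⁻¹ • ω).1 0 = x) ∨
      (x ∉ T ∧ x ≠ a ∧ x ≠ linv a ∧ ω.1 0 = x) := by
  set τ := whitehead a T ha ha' with hτ
  set ξ := (letter a)⁻¹ • ω with hξ
  have hconv : ConvergesTo (fun n => letter a * pre ξ n) ω := by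
    have := (convergesTo_pre ξ).smul (letter a)
    rwa [hξ, smul_inv_smul] at this
  have hpos : ∀ᶠ n : ℕ in atTop, 0 < n := eventually_gt_atTop 0
  have key : ∀ x, ((x = a ∧ ξ.1 0 ∉ insert (linv a) T) ∨ (x = linv a ∧ ω.1 0 ∈ insert (linv a) T) ∨
      (x ∈ T ∧ ξ.1 0 = x) ∨ (x ∉ T ∧ x ≠ a ∧ x ≠ linv a ∧ ω.1 0 = x)) →
      (bdHomeo τ ω).1 0 = x := by
    rintro x (⟨rfl, h⟩ | ⟨rfl, h⟩ | ⟨hx, h⟩ | ⟨hx, hxa, hxa', h⟩)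
    · refine bdHomeo_head_of_piece ha ha' hconv (hpos.mono fun n hn => Or.inl ⟨rfl, fun s hs => ?_⟩)
      rw [inv_mul_cancel_left, head_pre ξ hn]
      exact fun e => h (Option.some_injective _ e ▸ hs)
    · exact bdHomeo_head_of_piece ha ha' (convergesTo_pre ω)
        (hpos.mono fun n hn => Or.inr (Or.inl ⟨rfl, _, h, head_pre ω hn⟩))
    · refine bdHomeo_head_of_piece ha ha' hconv
        (hpos.mono fun n hn => Or.inr (Or.inr (Or.inl ⟨hx, ?_⟩)))
      rw [inv_mul_cancel_left, head_pre ξ hn, h]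
    · exact bdHomeo_head_of_piece ha ha' (convergesTo_pre ω)
        (hpos.mono fun n hn => Or.inr (Or.inr (Or.inr ⟨hx, hxa, hxa', by rw [head_pre ω hn, h]⟩)))
  refine ⟨fun h => ?_, key x⟩
  -- every ray satisfies one of the four conditions for some letter
  have hsome : ∃ x, (x = a ∧ ξ.1 0 ∉ insert (linv a) T) ∨
      (x = linv a ∧ ω.1 0 ∈ insert (linv a) T) ∨ (x ∈ T ∧ ξ.1 0 = x) ∨
      (x ∉ T ∧ x ≠ a ∧ x ≠ linv a ∧ ω.1 0 = x) := by
    by_cases h1 : ω.1 0 ∈ insert (linv a) T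
    · exact ⟨_, Or.inr (Or.inl ⟨rfl, h1⟩)⟩
    by_cases h2 : ω.1 0 = a
    · by_cases h3 : ξ.1 0 ∈ insert (linv a) T
      · rcases h3 with h3 | h3
        · have h4 := letter_smul_head a ξ
          rw [hξ, smul_inv_smul, ← hξ] at h4
          exact absurd h3 (h4.1 h2)
        · exact ⟨_, Or.inr (Or.inr (Or.inl ⟨h3, rfl⟩))⟩
      · exact ⟨_, Or.inl ⟨rfl, h3⟩⟩
    · rw [Set.mem_insert_iff, not_or] at h1
      exact ⟨_, Or.inr (Or.inr (Or.inr ⟨h1.2, h2, h1.1, rfl⟩))⟩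
  obtain ⟨y, hy⟩ := hsome
  obtain rfl : y = x := (key y hy).symm.trans h
  exact hy

theorem cost_sectors_linv (hk : 2 ≤ k) (φ : MulAut (FreeGroup (Fin k))) (a : Letter k) :
    cost φ (sectors {linv a}) = cost φ (sectors {a}) := by
  rw [← cost_smul hk φ (letter a) (isClopen_sectors {a}), ← cost_compl hk φ (isClopen_sectors _)]
  congr 1
  ext ω
  exact (letter_smul_head a ω).symm

/-- Replacing the direction `a` by the set of directions `S` is a Whitehead move: it replaces the
cost of the directions `a` and `a⁻¹` by the cost of `S` and leaves the other costs unchanged. -/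
theorem exists_whitehead_length_lt (hk : 2 ≤ k) (φ : MulAut (FreeGroup (Fin k))) {a : Letter k}
    {S : Set (Letter k)} (haS : a ∈ S) (haS' : linv a ∉ S)
    (hlt : cost φ (sectors S) < cost φ (sectors {a})) :
    ∃ τ : MulAut (FreeGroup (Fin k)), IsWhiteheadSecondKind τ ∧
      ((τ * φ) • uniformCurrent k hk).length < (φ • uniformCurrent k hk).length := by
  have h1 : linv a ∉ S \ {a} := fun h => haS' h.1
  have h2 : linv (linv a) ∉ S \ {a} := fun h => h.2 (by simp)
  have hins : insert (linv (linv a)) (S \ {a}) = S := by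
    rw [linv_linv, Set.insert_sdiff_singleton, Set.insert_eq_of_mem haS]
  refine ⟨whitehead (linv a) (S \ {a}) h1 h2, isWhiteheadSecondKind_whitehead h1 h2, ?_⟩
  have hhead := bdHomeo_whitehead_head h1 h2
  rw [hins] at hhead
  rw [length_smul_uniformCurrent, length_smul_uniformCurrent]
  simp only [cost_mul]
  generalize whitehead (linv a) (S \ {a}) h1 h2 = τ at *
  have hne := linv_ne a
  have hself : cost φ (bdHomeo τ ⁻¹' sectors {a}) = cost φ (sectors S) := by
    congr 1
    ext ω
    refine (hhead ω a).trans ?_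
    simp [hne.symm, sectors]
  have hinv : cost φ (bdHomeo τ ⁻¹' sectors {linv a}) = cost φ (sectors S) := by
    rw [← cost_compl hk φ (isClopen_sectors S),
      ← cost_smul hk φ (letter (linv a))⁻¹ (isClopen_sectors S).compl]
    congr 1
    ext ω
    refine (hhead ω (linv a)).trans ?_
    simp [hne, haS', sectors]
  refine Finset.sum_lt_sum (fun x _ => ?_) ⟨a, Finset.mem_univ a, hself.trans_lt hlt⟩
  by_cases hxa : x = a
  · rw [hxa, hself]; exact hlt.le
  by_cases hxa' : x = linv a
  · rw [hxa', hinv, cost_sectors_linv hk]; exact hlt.le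
  by_cases hxS : x ∈ S
  · rw [← cost_smul hk φ (letter (linv a))⁻¹ (isClopen_sectors {x})]
    refine le_of_eq (congrArg _ (Set.ext fun ω => (hhead ω x).trans ?_))
    simp [hxa, hxa', hxS, sectors]
  · refine le_of_eq (congrArg _ (Set.ext fun ω => (hhead ω x).trans ?_))
    simp [hxa, hxa', hxS, sectors]

end whitehead

/-! ### The descent -/

section descent

variable {k : ℕ}

/-- The ray `s s s …`. -/
def constRay (s : Letter k) : Boundary k := ⟨fun _ => s, fun _ _ => rfl⟩

theorem letter_smul_constRay (s : Letter k) : letter s • constRay s = constRay s := by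
  refine ((convergesTo_pre (constRay s)).smul (letter s)).unique fun i => ?_
  have e : ∀ n, letter s * pre (constRay s) n = pre (constRay s) (n + 1) := by
    intro n
    simp only [letter, pre, FreeGroup.mul_mk, List.range_succ_eq_map]
    simp [constRay, Function.comp_def]
  simp only [e]
  exact (tendsto_add_atTop_nat 1).eventually (convergesTo_pre (constRay s) i)

/-- A translate of the axis of `b` either misses the vertex `1`, and then both of its ends lie in
the same direction at `1`, or it passes through `1` in the directions `b` and `b⁻¹`. -/
theorem smul_constRay_head (b : Letter k) (g : FreeGroup (Fin k)) :
    (g • constRay b).1 0 = (g • constRay (linv b)).1 0 ∨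
      ((g • constRay b).1 0 = b ∧ (g • constRay (linv b)).1 0 = linv b) := by
  have hb : (letter b)⁻¹ • constRay b = constRay b := by
    rw [inv_smul_eq_iff, letter_smul_constRay]
  have hb' : letter b • constRay (linv b) = constRay (linv b) := by
    have h := letter_smul_constRay (linv b)
    rw [letter_linv, inv_smul_eq_iff] at h
    exact h.symm
  induction hn : g.norm generalizing g with
  | zero =>
    obtain rfl : g = 1 := by simpa using hn
    right
    simp only [one_smul]
    exact ⟨rfl, rfl⟩
  | succ n ih =>
    obtain ⟨y, l, rfl, hl⟩ := exists_last (x := g) (by rintro rfl; simp at hn)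
    by_cases h1 : l = b
    · rw [h1, mul_smul, letter_smul_constRay, mul_smul, hb']
      exact ih y (by omega)
    by_cases h2 : l = linv b
    · rw [h2, mul_smul, mul_smul, letter_smul_constRay, letter_linv, hb]
      exact ih y (by omega)
    · left
      have key : ∀ c : Letter k, c ≠ linv l →
          y * letter l ≠ 1 ∧ (y * letter l) • constRay c ∈ shadow (y * letter l) := by
        intro c hc
        refine ⟨fun e => by rw [e] at hn; simp at hn, ?_⟩
        rw [mem_shadow_iff_head hl, inv_smul_smul]
        exact hc
      obtain ⟨h3, h4⟩ := key b fun e => h2 (by rw [e, linv_linv])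
      obtain ⟨-, h5⟩ := key (linv b) fun e => h1 (linv_injective e).symm
      exact Option.some_injective _
        ((head_of_mem_shadow h3 h4).symm.trans (head_of_mem_shadow h3 h5))

theorem cost_one_shadow (hk : 2 ≤ k) {v : FreeGroup (Fin k)} (hv : v ≠ 1) :
    cost 1 (shadow v) = 1 / (2 * k : ℝ) := by
  obtain ⟨y, l, rfl, hl⟩ := exists_last hv
  rw [← cost_one_sectors_singleton hk l, ← cost_smul hk 1 y⁻¹ (isClopen_sectors {l})]
  congr 1
  ext ω
  exact (inv_smul_head hl ω).symm

/-- If a set `W` of minimal cost is, outside of the direction `f`, the union of the directions in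
`S`, and `W` crosses `f`, then uncrossing shows that `S` is cheaper than `f`. -/
theorem cost_sectors_lt_of_crossing (hk : 2 ≤ k) (φ : MulAut (FreeGroup (Fin k)))
    {W : Set (Boundary k)} (hW : IsClopen W) (hcW : cost φ W = 1 / (2 * k)) {f : Letter k}
    {S : Set (Letter k)} (ht : ∃ s, s ∉ S ∧ s ≠ f)
    (hWS : W ∩ (sectors {f})ᶜ = sectors S) (hin : (W ∩ sectors {f}).Nonempty)
    (hout : (Wᶜ ∩ sectors {f}).Nonempty) : cost φ (sectors S) < cost φ (sectors {f}) := by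
  obtain ⟨s, hs, hsf⟩ := ht
  have hs' : constRay s ∈ (sectors {f})ᶜ \ W :=
    ⟨hsf, fun h => hs (show constRay s ∈ sectors S by rw [← hWS]; exact ⟨h, hsf⟩)⟩
  have h1 := cost_inter_add_cost_union_lt hk φ hW (isClopen_sectors {f}).compl
    (by rwa [Set.sdiff_eq, compl_compl]) ⟨_, hs'⟩
  have h2 := cost_lower hk φ (hW.union (isClopen_sectors {f}).compl) ⟨_, Or.inr hs'.1⟩
    (by rwa [Set.compl_union, compl_compl])
  rw [hWS, cost_compl hk φ (isClopen_sectors _), hcW] at h1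
  linarith

/-- Unless `φ` is simple, some direction can be replaced by a cheaper set of directions. -/
theorem exists_cost_sectors_lt (hk : 2 ≤ k) (φ : MulAut (FreeGroup (Fin k))) (hφ : ¬ IsSimple φ) :
    ∃ (a : Letter k) (S : Set (Letter k)), a ∈ S ∧ linv a ∉ S ∧
      cost φ (sectors S) < cost φ (sectors {a}) := by
  obtain ⟨b, hb⟩ : ∃ b, 1 / (2 * k : ℝ) < cost φ (sectors {b}) := by
    by_contra! h
    exact hφ (isSimple_of_cost_eq hk φ fun s => le_antisymm (h s)
      (cost_lower hk φ (isClopen_sectors {s}) (sectors_singleton_nonempty s)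
        (sectors_compl_singleton_nonempty hk s)))
  -- a half-tree `H` of the original tree whose image separates the ends of the axis of `b`
  set p := (bdHomeo φ).symm (constRay b) with hp
  set p' := (bdHomeo φ).symm (constRay (linv b)) with hp'
  have hpp : p ≠ p' := by
    intro e
    have := congrArg (fun ω : Boundary k => ω.1 0) ((bdHomeo φ).symm.injective e)
    exact linv_ne b this.symm
  obtain ⟨n, hn⟩ := exists_pre_ne ⟨(p, p'), hpp⟩
  have hne : pre p n ≠ pre p' n := hn n le_rfl
  set v := pre p n with hv
  have hv1 : v ≠ 1 := by
    intro e
    have h0 : n = 0 := by rw [← norm_pre p n, ← hv, e]; simp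
    rw [hv, h0] at hne
    exact hne (by simp [pre])
  have hpv : p ∈ shadow v := by simp [shadow, hv, norm_pre]
  have hpv' : p' ∉ shadow v := by
    intro h
    have h' : pre p' v.norm = v := h
    rw [hv, norm_pre] at h'
    exact hne h'.symm
  set H := (bdHomeo φ).symm ⁻¹' shadow v with hH
  have hHc : IsClopen H := (isClopen_shadow v).preimage (bdHomeo φ).symm.continuous
  have hcH : cost φ H = 1 / (2 * k) := by
    rw [cost_eq_cost_one, ← cost_one_shadow hk hv1]
    congr 1
    ext ω
    simp [hH]
  have hbH : constRay b ∈ H := hpv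
  have hbH' : constRay (linv b) ∉ H := hpv'
  obtain ⟨N, hN⟩ := exists_isLevel hHc
  obtain ⟨u, -, ⟨S, hS⟩ | ⟨f, S, hf, ⟨t, ht⟩, hout, hWS, hin, hin'⟩⟩ :=
    exists_vertex hN ⟨_, hbH⟩ ⟨_, hbH'⟩
  · have h1 : (u⁻¹ • constRay b).1 0 ∈ S := by
      change _ ∈ sectors S
      rw [← hS]; simpa using hbH
    have h2 : (u⁻¹ • constRay (linv b)).1 0 ∉ S := by
      change ¬ _ ∈ sectors S
      rw [← hS]; simpa using hbH'
    rcases smul_constRay_head b u⁻¹ with h | ⟨h, h'⟩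
    · exact absurd (h ▸ h1) h2
    · rw [h] at h1
      rw [h'] at h2
      refine ⟨b, S, h1, h2, ?_⟩
      rw [← hS, cost_smul hk φ u hHc, hcH]
      exact hb
  · have hW := isClopen_smul_preimage u hHc
    have hcW := (cost_smul hk φ u hHc).trans hcH
    generalize {ω | u • ω ∈ H} = W at *
    by_cases hfS : linv f ∈ S
    · refine ⟨linv f, S, hfS, by rwa [linv_linv], ?_⟩
      rw [cost_sectors_linv hk]
      exact cost_sectors_lt_of_crossing hk φ hW hcW hout hWS hin hin'
    · -- the same argument for the complement of `W`
      refine ⟨linv f, {s | s ∉ S ∧ s ≠ f}, ⟨hfS, linv_ne f⟩, by simp, ?_⟩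
      rw [cost_sectors_linv hk]
      refine cost_sectors_lt_of_crossing hk φ hW.compl ((cost_compl hk φ hW).trans hcW)
        ⟨t, fun h => h.1 ht, fun h => hf (h ▸ ht)⟩ (Set.ext fun ω => ?_) hin' (by rwa [compl_compl])
      have := Set.ext_iff.1 hWS ω
      simp only [sectors, Set.mem_inter_iff, Set.mem_compl_iff, Set.mem_ofPred_eq,
        Set.mem_singleton_iff] at this ⊢
      tauto

end descent

end FreeCurrents

theorem mainTheorem2 (k : ℕ) (hk : 2 ≤ k) (φ : MulAut (FreeGroup (Fin k)))
    (hφ : ¬ FreeCurrents.IsSimple φ) :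
    ∃ τ : MulAut (FreeGroup (Fin k)), FreeCurrents.IsWhiteheadSecondKind τ ∧
      1 = (FreeCurrents.uniformCurrent k hk).length ∧
      (FreeCurrents.uniformCurrent k hk).length ≤
        ((τ * φ) • FreeCurrents.uniformCurrent k hk).length ∧
      ((τ * φ) • FreeCurrents.uniformCurrent k hk).length <
        (φ • FreeCurrents.uniformCurrent k hk).length := by
  obtain ⟨a, S, h1, h2, h3⟩ := FreeCurrents.exists_cost_sectors_lt hk φ hφ
  obtain ⟨τ, hτ, hlt⟩ := FreeCurrents.exists_whitehead_length_lt hk φ h1 h2 h3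
  have hL := FreeCurrents.length_uniformCurrent hk
  exact ⟨τ, hτ, hL.symm, hL.trans_le (FreeCurrents.one_le_length hk (τ * φ)), hlt⟩
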